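/- Let $a<b$, $T>0$, $1<\alpha<2$, $K\ge 0$, $K_\alpha>0$, and put $C_\alpha=-\frac{1}{2\cos(\pi\alpha/2)}$. For $x\in(a,b)$ the Riesz derivative of order $\alpha$ is $$\frac{\partial^\alpha v(x)}{\partial|x|^\alpha}=\frac{C_\alpha}{\Gamma(2-\alpha)}\frac{d^2}{dx^2}\left(\int_a^x\frac{v(s)\,ds}{(x-s)^{\alpha-1}}+\int_x^b\frac{v(s)\,ds}{(s-x)^{\alpha-1}}\right).$$ Let $u$ be a solution of $$\frac{\partial u}{\partial t}+K\frac{\partial u}{\partial x}=K_\alpha\frac{\partial^\alpha u}{\partial|x|^\alpha}+f(x,t),\qquad a<x<b,\ 0<t\le T,$$ with $u(x,0)=u^0(x)$ for $a<x<b$ and $u(a,t)=u(b,t)=0$ for $0\le t\le T$. Assume the following smoothness. (i) For every $t\in[0,T]$ the extension of $u(\cdot,t)$ from $[a,b]$ to $\mathbb R$ by zero is in $C^3(\mathbb R)$, and its third derivative is an indefinite integral of a function of bounded variation on $\mathbb R$ whose total variation is bounded independently of $t$. (This holds for instance if the extensions are in $C^4(\mathbb R)$ and have fifth derivatives bounded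 in $L^1(\mathbb R)$ uniformly in $t$.) (ii) For every $x\in(a,b)$, $u(x,\cdot)\in C^3[0,T]$ and $f(x,\cdot)\in C^2[0,T]$, and $\partial_t^3u$ and $\partial_t^2 f$ are bounded on $(a,b)\times[0,T]$. Let $\kappa_\ell$ be the coefficients of the power series $$\left(\frac{3\alpha-2}{2\alpha}-\frac{2(\alpha-1)}{\alpha}z+\frac{\alpha-2}{2\alpha}z^2\right)^{\alpha}=\sum_{\ell=0}^\infty\kappa_\ell z^\ell,\qquad |z|<1.$$ For positive integers $M,N$ put $h=\frac{b-a}{M}$, $\tau=\frac TN$, $x_j=a+jh$, $t_k=k\tau$, and for a grid function $v=(v_0,\dots,v_M)$ and $1\le j\le M-1$ put $$\delta_{\bar x}v_j=\frac{v_{j+1}-v_{j-1}}{2h},\qquad \delta_x^\alpha v_j=\frac{C_\alpha}{h^\alpha}\left(\sum_{\ell=0}^{j+1}\kappa_\ell v_{j-\ell+1}+\sum_{\ell=0}^{M-j+1}\kappa_\ell v_{j+\ell-1}\right).$$ Consider the Crank–Nicolson scheme $$\frac{U_j^{k+1}-U_j^k}{\tau}+K\,\delta_{\bar x}U_j^{k+\frac12}=K_\alpha\,\delta_x^\alpha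 U_j^{k+\frac12}+f_j^{k+\frac12},\qquad 0\le k\le N-1,\ 1\le j\le M-1,$$ $$U_j^0=u^0(x_j)\ (0\le j\le M),\qquad U_0^k=U_M^k=0\ (0\le k\le N),$$ where $U_j^{k+\frac12}=\frac12(U_j^{k+1}+U_j^k)$, and where $f_j^{k+\frac12}$ is either $f(x_j,t_k+\frac{\tau}{2})$ for all $j,k$ or $\frac12(f(x_j,t_k)+f(x_j,t_{k+1}))$ for all $j,k$. Then the scheme is convergent with order $\mathcal O(\tau^2+h^2)$: there is a constant $c>0$, independent of $M$ and $N$ (and so of $h$ and $\tau$), such that every solution $U$ of the scheme satisfies $$\left(h\sum_{j=1}^{M-1}\bigl(u(x_j,t_k)-U_j^k\bigr)^2\right)^{1/2}\le c\,(\tau^2+h^2),\qquad 0\le k\le N.$$ -/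

import Mathlib

noncomputable section

namespace RieszScheme

/-! Fractional derivatives of order `1 < α < 2` on `(a, b)`. -/

/-- Left Riemann–Liouville derivative of order `α ∈ (1, 2)` with base point `a`. -/
def leftRL (a α : ℝ) (v : ℝ → ℝ) (x : ℝ) : ℝ :=
  1 / Real.Gamma (2 - α) *
    iteratedDeriv 2 (fun y => ∫ s in a..y, v s / (y - s) ^ (α - 1)) x

/-- Right Riemann–Liouville derivative of order `α ∈ (1, 2)` with base point `b`. -/
def rightRL (b α : ℝ) (v : ℝ → ℝ) (x : ℝ) : ℝ :=
  1 / Real.Gamma (2 - α) *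
    iteratedDeriv 2 (fun y => ∫ s in y..b, v s / (s - y) ^ (α - 1)) x

/-- The constant `C_α = -1 / (2 cos (π α / 2))`. -/
def rieszConst (α : ℝ) : ℝ := -1 / (2 * Real.cos (Real.pi / 2 * α))

/-- Riesz derivative of order `α ∈ (1, 2)` on `(a, b)`. -/
def rieszDeriv (a b α : ℝ) (v : ℝ → ℝ) (x : ℝ) : ℝ :=
  rieszConst α * (leftRL a α v x + rightRL b α v x)

/-! The advection–diffusion problem. -/

/-- `u` (written `u x t`) solves
`u_t + K u_x = Kα ∂^α u / ∂|x|^α + f` on `a < x < b`, `0 < t ≤ T`, with initial value `u0` and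
homogeneous Dirichlet conditions. The time derivative is one-sided at `t = T`. -/
structure IsSolution (a b T α K Kα : ℝ) (f : ℝ → ℝ → ℝ) (u0 : ℝ → ℝ)
    (u : ℝ → ℝ → ℝ) : Prop where
  equation : ∀ x ∈ Set.Ioo a b, ∀ t ∈ Set.Ioc 0 T,
    derivWithin (fun s => u x s) (Set.Icc 0 T) t + K * deriv (fun y => u y t) x =
      Kα * rieszDeriv a b α (fun y => u y t) x + f x t
  initial : ∀ x ∈ Set.Ioo a b, u x 0 = u0 x
  left_boundary : ∀ t ∈ Set.Icc 0 T, u a t = 0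
  right_boundary : ∀ t ∈ Set.Icc 0 T, u b t = 0

/-- Extension of `v` from `[a, b]` to the real line by zero. -/
def zeroExt (a b : ℝ) (v : ℝ → ℝ) : ℝ → ℝ := (Set.Icc a b).indicator v

/-- Spatial smoothness, uniform in time: for every `t ∈ [0, T]` the extension of `u(·, t)` by zero
is three times continuously differentiable on the line, and its third derivative is an
indefinite integral of a function `w` (the fourth derivative) of bounded variation, with a bound
`V` on the total variation that does not depend on `t`. If the extension is four times
continuously differentiable and has an integrable fifth derivative, then `w` is the fourth
derivative and its variation is the `L¹` norm of the fifth. -/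
def SpaceRegular (a b T : ℝ) (u : ℝ → ℝ → ℝ) : Prop :=
  ∃ V : NNReal, ∀ t ∈ Set.Icc 0 T,
    ContDiff ℝ 3 (zeroExt a b (fun x => u x t)) ∧
    ∃ w : ℝ → ℝ, eVariationOn w Set.univ ≤ (V : ENNReal) ∧
      ∀ x y : ℝ,
        iteratedDeriv 3 (zeroExt a b (fun x => u x t)) y -
          iteratedDeriv 3 (zeroExt a b (fun x => u x t)) x = ∫ s in x..y, w s

/-- Smoothness in time of order `n`: for every `x ∈ (a, b)` the function `g(x, ·)` is `n` times
continuously differentiable on `[0, T]`, and its `n`-th derivative is bounded uniformly in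
`x` and `t`. -/
def TimeRegular (n : ℕ) (a b T : ℝ) (g : ℝ → ℝ → ℝ) : Prop :=
  ∃ C : ℝ, ∀ x ∈ Set.Ioo a b,
    ContDiffOn ℝ n (fun t => g x t) (Set.Icc 0 T) ∧
    ∀ t ∈ Set.Icc 0 T, |iteratedDerivWithin n (fun t => g x t) (Set.Icc 0 T) t| ≤ C

/-! The difference operators. A grid function on `x_0, …, x_M` is a function `v : ℕ → ℝ` of which
only the values `v 0, …, v M` are used. -/

/-- The generating function
`((3α - 2)/(2α) - 2(α - 1)/α z + (α - 2)/(2α) z²) ^ α`. For `1 < α < 2` and `|z| < 1` its base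
is positive. -/
def genFun (α z : ℝ) : ℝ :=
  ((3 * α - 2) / (2 * α) - 2 * (α - 1) / α * z + (α - 2) / (2 * α) * z ^ 2) ^ α

/-- The coefficient `κ_ℓ` of `z ^ ℓ` in the power series of the generating function at `0`. -/
def kappa (α : ℝ) (l : ℕ) : ℝ :=
  iteratedDeriv l (genFun α) 0 / (l.factorial : ℝ)

/-- `h^{-α} ∑_{ℓ = 0}^{j + 1} κ_ℓ v_{j - ℓ + 1}`; here `j = (x_j - a) / h`. -/
def leftOp (α h : ℝ) (v : ℕ → ℝ) (j : ℕ) : ℝ :=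
  1 / h ^ α * ∑ l ∈ Finset.range (j + 2), kappa α l * v (j + 1 - l)

/-- `h^{-α} ∑_{ℓ = 0}^{M - j + 1} κ_ℓ v_{j + ℓ - 1}`, for `1 ≤ j ≤ M`; here
`M - j = (b - x_j) / h`. -/
def rightOp (α h : ℝ) (M : ℕ) (v : ℕ → ℝ) (j : ℕ) : ℝ :=
  1 / h ^ α * ∑ l ∈ Finset.range (M - j + 2), kappa α l * v (j + l - 1)

/-- The second-order difference approximation `δ_x^α` of the Riesz derivative. -/
def rieszOp (α h : ℝ) (M : ℕ) (v : ℕ → ℝ) (j : ℕ) : ℝ :=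
  rieszConst α * (leftOp α h v j + rightOp α h M v j)

/-- `δ_x v_{j - 1/2} = (v_j - v_{j-1}) / h`, for `1 ≤ j`. -/
def halfDiff (h : ℝ) (v : ℕ → ℝ) (j : ℕ) : ℝ := (v j - v (j - 1)) / h

/-- The central difference `(δ_x v_{j + 1/2} + δ_x v_{j - 1/2}) / 2`, for `1 ≤ j`. -/
def centralDiff (h : ℝ) (v : ℕ → ℝ) (j : ℕ) : ℝ :=
  (halfDiff h v (j + 1) + halfDiff h v j) / 2

/-- The discrete `L²` norm `(h ∑_{j=1}^{M-1} v_j²)^{1/2}`. -/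
def gridNorm (h : ℝ) (M : ℕ) (v : ℕ → ℝ) : ℝ :=
  Real.sqrt (h * ∑ j ∈ Finset.Icc 1 (M - 1), v j ^ 2)

/-! The scheme. Grid values are written `U k j`, with time level `k` and space index `j`. -/

/-- The source at the half time level: `f(x_j, t_{k+1/2})`. -/
def midSource (a h τ : ℝ) (f : ℝ → ℝ → ℝ) (k j : ℕ) : ℝ :=
  f (a + j * h) (((k : ℝ) + 1 / 2) * τ)

/-- The source at the half time level, averaged: `(f(x_j, t_k) + f(x_j, t_{k+1})) / 2`. -/
def avgSource (a h τ : ℝ) (f : ℝ → ℝ → ℝ) (k j : ℕ) : ℝ :=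
  (f (a + j * h) (k * τ) + f (a + j * h) (((k : ℝ) + 1) * τ)) / 2

/-- `U` solves the Crank–Nicolson scheme with spatial step `h`, time step `τ`, half-level source
values `F k j = f_j^{k+1/2}` and initial value `u0`. -/
structure IsSchemeSolution (a α K Kα h τ : ℝ) (M N : ℕ) (F : ℕ → ℕ → ℝ) (u0 : ℝ → ℝ)
    (U : ℕ → ℕ → ℝ) : Prop where
  step : ∀ k < N, ∀ j, 1 ≤ j → j < M →
    (U (k + 1) j - U k j) / τ + K * centralDiff h (fun i => (U (k + 1) i + U k i) / 2) j =
      Kα * rieszOp α h M (fun i => (U (k + 1) i + U k i) / 2) j + F k j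
  initial : ∀ j ≤ M, U 0 j = u0 (a + j * h)
  left_boundary : ∀ k ≤ N, U k 0 = 0
  right_boundary : ∀ k ≤ N, U k M = 0

end RieszScheme

end

/-! ### Binomial coefficients and their asymptotics -/

section

open Filter Topology Finset PowerSeries

namespace RieszScheme

/-! Subtracting the scheme from the equation, the error `e` satisfies the same Crank–Nicolson
recursion with a residual `r` as its source and zero initial and boundary values. The theorem is
stability plus consistency. Tested with `e' + e`, one step gives `‖e'‖ ≤ ‖e‖ + τ‖r‖` as soon as the
spatial operator has a nonnegative quadratic form; summing over at most `N = T / τ` steps leaves `T`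
times the bound of `r`.

Stability. The central difference is skew. For the Riesz part, the base of the generating function
is `A (1 - z) (1 + ρ z)`, with `A (1 + ρ) = 1` and `0 < ρ < 1`. Hence `∑ κ_l = 0`, and the
coefficients obey a three-term recurrence which yields `κ_l ≥ 0` for `l ≥ 3` and `κ_0 + κ_2 ≥ 0`.
The form of the left operator is `∑ κ_l T_l`, where `T_l` correlates `v` with its shift by `|l -
1|`. As `T_0 = T_2` and `T_l ≤ T_1`, it is at most `T_1` times a partial sum of the `κ_l`, hence
nonpositive (`sum_mul_leftOp_nonpos`). The right operator is its reflection.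

Consistency in space. The zero extension has a bounded fourth derivative `w`, so Taylor's formula
writes the difference operator and the Riemann–Liouville derivative as integrals of `w` against
explicit kernels. After scaling to unit step the kernels differ by `O((y + 2)^(1 - α))`
(`exists_abs_peanoKernel_le`); scaling back gives `h² (x + 2h - s)^(1 - α)`, integrable in `s`
because `α < 2`. For the kernel bound, four factors `1 - z` turn the cubes into a B-spline
polynomial. What is left is a weighted average of shifted coefficients of `(1 - z)^(α - 4)`, of
which only the mass and the mean matter at this order. The asymptotics `Γ(γ) binCoeff γ n = (n +
γ/2)^(γ - 1) + O(n^(γ - 3))` then reproduce the truncated power.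

Consistency in time is the trapezoidal rule, with a midpoint comparison for the source. -/

/-- The coefficient of `x ^ n` in `(1 - x) ^ (-γ)`. -/
noncomputable def binCoeff (γ : ℝ) (n : ℕ) : ℝ := ∏ i ∈ range n, (γ + i) / (i + 1)

@[simp] theorem binCoeff_zero (γ : ℝ) : binCoeff γ 0 = 1 := by simp [binCoeff]

theorem binCoeff_succ (γ : ℝ) (n : ℕ) :
    binCoeff γ (n + 1) = binCoeff γ n * ((γ + n) / (n + 1)) := by
  rw [binCoeff, prod_range_succ, ← binCoeff]

theorem succ_mul_binCoeff_succ (γ : ℝ) (n : ℕ) :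
    ((n : ℝ) + 1) * binCoeff γ (n + 1) = (γ + n) * binCoeff γ n := by
  have : (n : ℝ) + 1 ≠ 0 := by positivity
  rw [binCoeff_succ]; field_simp

/-- The derivative of `(1 - x)^(-γ)` is `γ (1 - x)^(-γ-1)`. -/
theorem succ_mul_binCoeff_succ' (γ : ℝ) (n : ℕ) :
    ((n : ℝ) + 1) * binCoeff γ (n + 1) = γ * binCoeff (γ + 1) n := by
  induction n with
  | zero => simp [binCoeff]
  | succ n ih =>
    have h : (n : ℝ) + 1 ≠ 0 := by positivity
    rw [succ_mul_binCoeff_succ, binCoeff_succ (γ + 1) n]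
    push_cast
    rw [show binCoeff γ (n + 1) = γ * binCoeff (γ + 1) n / (n + 1) by rw [← ih]; field_simp]
    field_simp
    ring

/-- Multiplying by `1 - x` lowers the exponent `γ + 1` to `γ`. -/
theorem binCoeff_succ_sub (γ : ℝ) (n : ℕ) :
    binCoeff (γ + 1) (n + 1) - binCoeff (γ + 1) n = binCoeff γ (n + 1) := by
  have h : (n : ℝ) + 1 ≠ 0 := by positivity
  have h1 := succ_mul_binCoeff_succ' γ n
  rw [binCoeff_succ (γ + 1), show binCoeff γ (n + 1) = γ * binCoeff (γ + 1) n / (n + 1) by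
    rw [← h1]; field_simp]
  field_simp
  ring

theorem one_sub_X_mul_mk_binCoeff (γ : ℝ) :
    (1 - X) * PowerSeries.mk (binCoeff (γ + 1)) = PowerSeries.mk (binCoeff γ) := by
  ext n
  rw [sub_mul, one_mul, map_sub]
  cases n with
  | zero => simp
  | succ n => simp [coeff_succ_X_mul, binCoeff_succ_sub]

theorem binCoeff_pos {γ : ℝ} (hγ : 0 < γ) (n : ℕ) : 0 < binCoeff γ n :=
  prod_pos fun i _ => by positivity

/-- Two sequences tending to zero can be compared through their increments. -/
theorem abs_le_of_abs_sub_le {x e : ℕ → ℝ} (hx : Tendsto x atTop (𝓝 0))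
    (he : Tendsto e atTop (𝓝 0)) (h : ∀ n, |x (n + 1) - x n| ≤ e n - e (n + 1)) (n : ℕ) :
    |x n| ≤ e n := by
  have key : ∀ m, |x (n + m) - x n| ≤ e n - e (n + m) := by
    intro m
    induction m with
    | zero => simp
    | succ m ih =>
      have h1 := h (n + m)
      rw [← add_assoc]
      have := abs_sub_le (x (n + m + 1)) (x (n + m)) (x n)
      linarith
  have hshift : Tendsto (fun m : ℕ => n + m) atTop atTop :=
    tendsto_atTop_mono (fun m => Nat.le_add_left m n) tendsto_id
  have h1 : Tendsto (fun m => |x (n + m) - x n|) atTop (𝓝 |0 - x n|) :=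
    ((hx.comp hshift).sub tendsto_const_nhds).abs
  have h2 : Tendsto (fun m => e n - e (n + m)) atTop (𝓝 (e n - 0)) :=
    tendsto_const_nhds.sub (he.comp hshift)
  simpa using le_of_tendsto_of_tendsto' h1 h2 key

/-- Cubic accuracy of `2 y` as an approximation of `log ((1 + y) / (1 - y))`. -/
theorem abs_log_one_add_sub_log_one_sub_le {y : ℝ} (hy : |y| ≤ 1 / 2) :
    |Real.log (1 + y) - Real.log (1 - y) - 2 * y| ≤ 4 * |y| ^ 3 := by
  have h1 := Real.abs_log_sub_add_sum_range_le (x := y) (by linarith) 2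
  have h2 := Real.abs_log_sub_add_sum_range_le (x := -y) (by rw [abs_neg]; linarith) 2
  simp only [sum_range_succ, range_zero, sum_empty, abs_neg, sub_neg_eq_add] at h1 h2
  have h3 : |y| ^ (2 + 1) / (1 - |y|) ≤ 2 * |y| ^ 3 := by
    norm_num only
    rw [div_le_iff₀ (by linarith)]
    nlinarith [mul_nonneg (pow_nonneg (abs_nonneg y) 3) (by linarith : 0 ≤ 1 - 2 * |y|)]
  have h1' := h1.trans h3
  have h2' := h2.trans h3
  rw [abs_le] at h1' h2' ⊢
  norm_num at h1' h2'
  constructor <;> nlinarith [h1'.1, h1'.2, h2'.1, h2'.2]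

/-- Euler's limit for `Γ`: the coefficient is `n^γ / ((n + γ) GammaSeq γ n)`. -/
theorem tendsto_Gamma_mul_binCoeff_div {γ : ℝ} (hγ : 0 < γ) :
    Tendsto (fun n : ℕ => Real.Gamma γ * binCoeff γ n / ((n : ℝ) + γ / 2) ^ (γ - 1)) atTop
      (𝓝 1) := by
  have hΓ := Real.Gamma_pos_of_pos hγ
  have h1 : Tendsto (fun n : ℕ => Real.Gamma γ / Real.GammaSeq γ n) atTop (𝓝 1) := by
    have := (tendsto_const_nhds (x := Real.Gamma γ)).div (Real.GammaSeq_tendsto_Gamma γ) hΓ.ne'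
    rwa [div_self hΓ.ne'] at this
  have h2 : Tendsto (fun n : ℕ => (n : ℝ) / (n + γ)) atTop (𝓝 1) :=
    tendsto_natCast_div_add_atTop γ
  have h3 : Tendsto (fun n : ℕ => ((n : ℝ) / (n + γ / 2)) ^ (γ - 1)) atTop (𝓝 1) := by
    have := (tendsto_natCast_div_add_atTop (γ / 2)).rpow_const (p := γ - 1) (Or.inl one_ne_zero)
    rwa [Real.one_rpow] at this
  have h4 := (h1.mul h2).mul h3
  rw [one_mul, one_mul] at h4
  refine h4.congr' ?_
  filter_upwards [eventually_gt_atTop 0] with n hn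
  have hn' : (0 : ℝ) < n := by exact_mod_cast hn
  have hprod : 0 < ∏ j ∈ range n, (γ + (j : ℝ)) := prod_pos fun i _ => by positivity
  have hfac : ∏ i ∈ range n, ((i : ℝ) + 1) = n.factorial := by
    rw [← prod_range_add_one_eq_factorial]; push_cast; rfl
  rw [Real.GammaSeq, prod_range_succ, binCoeff, prod_div_distrib, hfac,
    Real.div_rpow hn'.le (by positivity),
    show (n : ℝ) ^ (γ - 1) = n ^ γ / n by rw [Real.rpow_sub hn', Real.rpow_one]]
  have e1 : (n : ℝ) ^ γ ≠ 0 := by positivity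
  have e2 : ((n : ℝ) + γ / 2) ^ (γ - 1) ≠ 0 := by positivity
  have e3 : (n.factorial : ℝ) ≠ 0 := by positivity
  have e4 : (n : ℝ) + γ ≠ 0 := by positivity
  field_simp
  ring

theorem abs_exp_sub_one_le_mul_exp {x E : ℝ} (h : |x| ≤ E) :
    |Real.exp x - 1| ≤ Real.exp E * |x| := by
  have hE : 0 ≤ E := (abs_nonneg x).trans h
  have h1 : 1 ≤ Real.exp E := Real.one_le_exp hE
  have h2 := Real.add_one_le_exp x
  have h3 := Real.add_one_le_exp (-x)
  have h4 : Real.exp x * Real.exp (-x) = 1 := by rw [← Real.exp_add]; simp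
  have h5 : Real.exp x ≤ Real.exp E := Real.exp_le_exp.2 ((le_abs_self x).trans h)
  have h6 := Real.exp_pos x
  rw [abs_le]
  constructor
  · nlinarith [neg_abs_le x, abs_nonneg x]
  · have : Real.exp x - 1 ≤ Real.exp x * x := by nlinarith
    have h7 : Real.exp x * x ≤ Real.exp x * |x| := by gcongr; exact le_abs_self x
    have h8 : Real.exp x * |x| ≤ Real.exp E * |x| := by gcongr
    linarith

/-- The pairs `γ + n, n + 1` and `n + 1 + γ/2, n + γ/2` have the same midpoint `m`, so with
half-gaps `m y` and `m z` one has `y = (γ - 1) z` exactly. The linear terms of the logarithms cancel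
and cubic ones remain; this is why the asymptotics are centred at `n + γ/2`. -/
theorem abs_log_increment_le {γ : ℝ} (h0 : 0 < γ) (h3 : γ < 3) {n : ℕ} (hn : 1 ≤ n) :
    |Real.log (γ + n) - Real.log (n + 1) -
      (γ - 1) * (Real.log (n + 1 + γ / 2) - Real.log (n + γ / 2))| ≤ 40 / ((n : ℝ) + 1) ^ 3 := by
  have hn' : (1 : ℝ) ≤ n := by exact_mod_cast hn
  set m : ℝ := n + (γ + 1) / 2 with hm
  have hm0 : 0 < m := by positivity
  set z : ℝ := 1 / (2 * m) with hz
  have hz0 : 0 < z := by positivity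
  set y : ℝ := (γ - 1) * z with hy
  have hz1 : |z| ≤ 1 / 2 := by
    rw [abs_of_pos hz0, hz]
    rw [div_le_div_iff₀ (by positivity) (by norm_num)]
    linarith
  have hmz : 2 * m * z = 1 := by rw [hz]; field_simp
  have hy1 : |y| ≤ 1 / 2 := by
    rw [abs_le, hy]
    constructor <;> nlinarith
  have hyz : |y| ≤ 2 * z := by
    rw [abs_le, hy]
    constructor <;> nlinarith
  have hy2 := abs_le.1 hy1
  have hz2 := abs_le.1 hz1
  have e1 : γ + n = m * (1 + y) := by
    have : m * y = (γ - 1) / 2 := by rw [hy]; linear_combination (γ - 1) / 2 * hmz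
    linear_combination (-1 : ℝ) * this + hm.symm
  have e2 : (n : ℝ) + 1 = m * (1 - y) := by
    have : m * y = (γ - 1) / 2 := by rw [hy]; linear_combination (γ - 1) / 2 * hmz
    linear_combination this - hm
  have e3 : (n : ℝ) + 1 + γ / 2 = m * (1 + z) := by linear_combination -hmz / 2 - hm
  have e4 : (n : ℝ) + γ / 2 = m * (1 - z) := by linear_combination hmz / 2 - hm
  rw [e1, e3, e4]
  conv_lhs => rw [e2]
  rw [Real.log_mul hm0.ne' (by linarith), Real.log_mul hm0.ne' (by linarith),
    Real.log_mul hm0.ne' (by linarith), Real.log_mul hm0.ne' (by linarith)]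
  have a1 := abs_log_one_add_sub_log_one_sub_le hy1
  have a2 := abs_log_one_add_sub_log_one_sub_le hz1
  have key : Real.log m + Real.log (1 + y) - (Real.log m + Real.log (1 - y)) -
      (γ - 1) * (Real.log m + Real.log (1 + z) - (Real.log m + Real.log (1 - z))) =
      (Real.log (1 + y) - Real.log (1 - y) - 2 * y) -
      (γ - 1) * (Real.log (1 + z) - Real.log (1 - z) - 2 * z) := by rw [hy]; ring
  rw [key]
  have b1 : |y| ^ 3 ≤ (2 * z) ^ 3 := by gcongr
  have b2 : |γ - 1| ≤ 2 := by rw [abs_le]; constructor <;> linarith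
  have b3 : |(γ - 1) * (Real.log (1 + z) - Real.log (1 - z) - 2 * z)| ≤ 2 * (4 * z ^ 3) := by
    rw [abs_mul]
    rw [abs_of_pos hz0] at a2
    gcongr
  have b4 : z ≤ 1 / (n + 1) := by
    rw [hz]
    apply one_div_le_one_div_of_le (by positivity)
    linarith
  have b5 : z ^ 3 ≤ (1 / ((n : ℝ) + 1)) ^ 3 := by gcongr
  have b6 : 40 / ((n : ℝ) + 1) ^ 3 = 40 * (1 / ((n : ℝ) + 1)) ^ 3 := by
    rw [div_pow, one_pow]; ring
  rw [b6]
  calc _ ≤ |Real.log (1 + y) - Real.log (1 - y) - 2 * y| +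
        |(γ - 1) * (Real.log (1 + z) - Real.log (1 - z) - 2 * z)| := abs_sub _ _
    _ ≤ 4 * (2 * z) ^ 3 + 2 * (4 * z ^ 3) := by linarith
    _ = 40 * z ^ 3 := by ring
    _ ≤ _ := by linarith

/-- The logarithm `x n` of the ratio tends to zero with increments `O(n⁻³)`, hence is itself
`O(n⁻²)`. -/
theorem exists_abs_Gamma_mul_binCoeff_sub_le {γ : ℝ} (h0 : 0 < γ) (h3 : γ < 3) :
    ∃ C : ℝ, 0 < C ∧ ∀ n : ℕ,
      |Real.Gamma γ * binCoeff γ n - ((n : ℝ) + γ / 2) ^ (γ - 1)| ≤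
        C * ((n : ℝ) + 1) ^ (γ - 3) := by
  have hΓ := Real.Gamma_pos_of_pos h0
  set x : ℕ → ℝ := fun n =>
    Real.log (Real.Gamma γ * binCoeff γ n / ((n : ℝ) + γ / 2) ^ (γ - 1)) with hx
  have hxlim : Tendsto x atTop (𝓝 0) := by
    have := (tendsto_Gamma_mul_binCoeff_div h0).log one_ne_zero
    rwa [Real.log_one] at this
  have hxstep : ∀ n : ℕ, x (n + 1) - x n = Real.log (γ + n) - Real.log (n + 1) -
      (γ - 1) * (Real.log (n + 1 + γ / 2) - Real.log (n + γ / 2)) := by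
    intro n
    have p1 := binCoeff_pos h0 n
    simp only [hx]
    rw [binCoeff_succ, Real.log_div (by positivity) (by positivity),
      Real.log_div (by positivity) (by positivity), Real.log_mul (by positivity) (by positivity),
      Real.log_mul (by positivity) (by positivity), Real.log_mul (by positivity) (by positivity),
      Real.log_rpow (by positivity), Real.log_rpow (by positivity),
      Real.log_div (by positivity) (by positivity)]
    push_cast
    ring
  -- The increment estimate requires `n ≥ 1`; the maximum covers `n = 0`.
  set A : ℝ := max 40 |x 1 - x 0| with hA
  have hA0 : 0 < A := lt_of_lt_of_le (by norm_num) (le_max_left _ _)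
  have hstep : ∀ n : ℕ, |x (n + 1) - x n| ≤ A / ((n : ℝ) + 1) ^ 3 := by
    intro n
    rcases Nat.eq_zero_or_pos n with rfl | hn
    · simp [hA]
    · rw [hxstep]
      refine (abs_log_increment_le h0 h3 hn).trans ?_
      gcongr
      exact le_max_left _ _
  -- With `k = n + 1`, the drop `2A/k² - 2A/(k+1)²` dominates `A/k³`.
  have hbound : ∀ n : ℕ, |x n| ≤ 2 * A / ((n : ℝ) + 1) ^ 2 := by
    apply abs_le_of_abs_sub_le hxlim
    · have h1 : Tendsto (fun n : ℕ => ((n : ℝ) + 1) ^ 2) atTop atTop :=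
        (tendsto_pow_atTop two_ne_zero).comp
          (tendsto_atTop_add_const_right _ _ tendsto_natCast_atTop_atTop)
      exact h1.const_div_atTop _
    · intro n
      refine (hstep n).trans ?_
      push_cast
      rw [div_sub_div _ _ (by positivity) (by positivity),
        div_le_div_iff₀ (by positivity) (by positivity)]
      have hn : (0 : ℝ) ≤ n := n.cast_nonneg
      set k : ℝ := n + 1 with hk
      have hk1 : 1 ≤ k := by linarith
      have : 0 ≤ A * k ^ 2 * (2 * k * (2 * k + 1) - (k + 1) ^ 2) :=
        mul_nonneg (by positivity) (by nlinarith)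
      nlinarith [this]
  -- The two summands bound the power of `(n + γ/2)/(n + 1)` for `γ ≥ 1` and for `γ < 1`, where the
  -- exponent is negative.
  set R : ℝ := (3 / 2) ^ (2 : ℝ) + (γ / 2) ^ (γ - 1) with hR
  have hratio : ∀ n : ℕ, ((n : ℝ) + γ / 2) ^ (γ - 1) ≤ R * ((n : ℝ) + 1) ^ (γ - 1) := by
    intro n
    have hn : (0 : ℝ) ≤ n := n.cast_nonneg
    rw [← div_le_iff₀ (by positivity), ← Real.div_rpow (by positivity) (by positivity)]
    rcases le_or_gt 1 γ with h1 | h1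
    · have t1 : (((n : ℝ) + γ / 2) / (n + 1)) ^ (γ - 1) ≤ (3 / 2) ^ (γ - 1) := by
        apply Real.rpow_le_rpow (by positivity) _ (by linarith)
        rw [div_le_iff₀ (by positivity)]; linarith
      have t2 : ((3 : ℝ) / 2) ^ (γ - 1) ≤ (3 / 2) ^ (2 : ℝ) :=
        Real.rpow_le_rpow_of_exponent_le (by norm_num) (by linarith)
      have t3 : 0 < (γ / 2) ^ (γ - 1) := by positivity
      linarith
    · have t1 : (((n : ℝ) + γ / 2) / (n + 1)) ^ (γ - 1) ≤ (γ / 2) ^ (γ - 1) := by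
        apply Real.rpow_le_rpow_of_nonpos (by positivity) _ (by linarith)
        rw [le_div_iff₀ (by positivity)]; nlinarith
      have t3 : 0 < ((3 : ℝ) / 2) ^ (2 : ℝ) := by positivity
      linarith
  have hR0 : 0 < R := by positivity
  refine ⟨R * (Real.exp (2 * A) * (2 * A)), by positivity, fun n => ?_⟩
  have p1 := binCoeff_pos h0 n
  have hP : 0 < ((n : ℝ) + γ / 2) ^ (γ - 1) := by positivity
  have hq : Real.Gamma γ * binCoeff γ n - ((n : ℝ) + γ / 2) ^ (γ - 1) =
      ((n : ℝ) + γ / 2) ^ (γ - 1) * (Real.exp (x n) - 1) := by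
    simp only [hx]
    rw [Real.exp_log (by positivity)]
    field_simp
  have hE : |x n| ≤ 2 * A := by
    refine (hbound n).trans (div_le_self (by positivity) ?_)
    have hn : (0 : ℝ) ≤ n := n.cast_nonneg
    nlinarith
  rw [hq, abs_mul, abs_of_pos hP]
  calc _ ≤ (R * ((n : ℝ) + 1) ^ (γ - 1)) * (Real.exp (2 * A) * (2 * A / ((n : ℝ) + 1) ^ 2)) := by
        gcongr
        · exact hratio n
        · exact (abs_exp_sub_one_le_mul_exp hE).trans (by gcongr; exact hbound n)
    _ = _ := by
        rw [show γ - 3 = γ - 1 - (2 : ℕ) by push_cast; ring,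
          Real.rpow_sub_natCast (by positivity)]
        ring

end RieszScheme

end

/-! ### Factorization of the generating function and the recurrence for its coefficients -/

section

open Filter Topology Finset PowerSeries

namespace RieszScheme

/-- The induction is on germs at zero, since differentiating once more needs the formula on a
neighbourhood. -/
theorem iteratedDeriv_one_add_mul_rpow (α c : ℝ) (n : ℕ) :
    iteratedDeriv n (fun z : ℝ => (1 + c * z) ^ α) 0 =
      n.factorial * (binCoeff (-α) n * (-c) ^ n) := by
  have hnear : ∀ᶠ z : ℝ in 𝓝 0, 0 < 1 + c * z := by
    have : ContinuousAt (fun z : ℝ => 1 + c * z) 0 := by fun_prop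
    exact this.eventually (lt_mem_nhds (by simp))
  have key : iteratedDeriv n (fun z : ℝ => (1 + c * z) ^ α) =ᶠ[𝓝 0]
      fun z => n.factorial * (binCoeff (-α) n * (-c) ^ n) * (1 + c * z) ^ (α - n) := by
    induction n with
    | zero => simp [iteratedDeriv_zero]
    | succ n ih =>
      rw [iteratedDeriv_succ]
      refine ih.deriv.trans ?_
      filter_upwards [hnear] with z hz
      have h1 : HasDerivAt (fun z : ℝ => 1 + c * z) c z := by
        simpa using ((hasDerivAt_id z).const_mul c).const_add 1
      have h2 := (h1.rpow_const (p := α - n) (Or.inl hz.ne')).const_mul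
        (n.factorial * (binCoeff (-α) n * (-c) ^ n))
      rw [h2.deriv, Nat.factorial_succ]
      have h3 := succ_mul_binCoeff_succ (-α) n
      push_cast
      rw [show α - (n + 1) = α - n - 1 by ring]
      linear_combination (-((n.factorial : ℝ)) * (-c) ^ (n + 1) * (1 + c * z) ^ (α - n - 1)) * h3
  rw [key.self_of_nhds]
  simp

theorem contDiffAt_one_add_mul_rpow (α c : ℝ) (n : ℕ) :
    ContDiffAt ℝ n (fun z : ℝ => (1 + c * z) ^ α) 0 := by
  apply ContDiffAt.rpow_const_of_ne
  · fun_prop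
  · simp

/-- The leading coefficient of the generating polynomial, in the form
`(1 - z) * (1 + smoothRatio α * z) * leadCoeff α`. -/
noncomputable def leadCoeff (α : ℝ) : ℝ := (3 * α - 2) / (2 * α)

/-- The ratio `ρ` in the factorization of the generating polynomial. -/
noncomputable def smoothRatio (α : ℝ) : ℝ := (2 - α) / (3 * α - 2)

/-- The coefficient of `z ^ l` in `(leadCoeff α * (1 + smoothRatio α * z)) ^ α`. -/
noncomputable def smoothCoeff (α : ℝ) (l : ℕ) : ℝ :=
  leadCoeff α ^ α * (binCoeff (-α) l * (-smoothRatio α) ^ l)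

theorem leadCoeff_pos {α : ℝ} (h1 : 1 < α) : 0 < leadCoeff α := by
  unfold leadCoeff; apply div_pos <;> linarith

theorem leadCoeff_lt_one {α : ℝ} (h1 : 1 < α) (h2 : α < 2) : leadCoeff α < 1 := by
  unfold leadCoeff; rw [div_lt_one (by linarith)]; linarith

theorem smoothRatio_pos {α : ℝ} (h1 : 1 < α) (h2 : α < 2) : 0 < smoothRatio α := by
  unfold smoothRatio; apply div_pos <;> linarith

theorem smoothRatio_lt_one {α : ℝ} (h1 : 1 < α) : smoothRatio α < 1 := by
  unfold smoothRatio; rw [div_lt_one (by linarith)]; linarith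

/-- The factor other than `1 - z` equals 1 at `z = 1`, so the generating function behaves like `(1 -
z)^α` there. -/
theorem leadCoeff_mul {α : ℝ} (h1 : 1 < α) : leadCoeff α * (1 + smoothRatio α) = 1 := by
  have e1 : 3 * α - 2 ≠ 0 := by linarith
  have e2 : α ≠ 0 := by linarith
  unfold leadCoeff smoothRatio
  field_simp
  ring

/-- Near zero the base factors as `A (1 + ρ z) (1 - z)` with positive factors, so the power splits,
and Leibniz's rule at zero is the Cauchy product. -/
theorem mk_kappa {α : ℝ} (h1 : 1 < α) :
    PowerSeries.mk (kappa α) = PowerSeries.mk (smoothCoeff α) * PowerSeries.mk (binCoeff (-α)) := by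
  have hA := leadCoeff_pos h1
  have hfun : genFun α =ᶠ[𝓝 0]
      (fun z => leadCoeff α ^ α * (1 + smoothRatio α * z) ^ α) * fun z => (1 + (-1) * z) ^ α := by
    have n1 : ∀ᶠ z : ℝ in 𝓝 0, 0 < 1 + smoothRatio α * z := by
      have : ContinuousAt (fun z : ℝ => 1 + smoothRatio α * z) 0 := by fun_prop
      exact this.eventually (lt_mem_nhds (by simp))
    have n2 : ∀ᶠ z : ℝ in 𝓝 0, 0 < 1 + (-1) * z := by
      have : ContinuousAt (fun z : ℝ => 1 + (-1) * z) 0 := by fun_prop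
      exact this.eventually (lt_mem_nhds (by simp))
    filter_upwards [n1, n2] with z hz1 hz2
    have e1 : 3 * α - 2 ≠ 0 := by linarith
    have e2 : α ≠ 0 := by linarith
    have : (3 * α - 2) / (2 * α) - 2 * (α - 1) / α * z + (α - 2) / (2 * α) * z ^ 2 =
        leadCoeff α * (1 + smoothRatio α * z) * (1 + (-1) * z) := by
      unfold leadCoeff smoothRatio
      field_simp
      ring
    rw [genFun, this, Real.mul_rpow (by positivity) hz2.le, Real.mul_rpow hA.le hz1.le]
    rfl
  ext l
  rw [coeff_mk, kappa, (hfun.iteratedDeriv_eq l), iteratedDeriv_mul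
    (contDiffAt_const.mul (contDiffAt_one_add_mul_rpow _ _ _)) (contDiffAt_one_add_mul_rpow _ _ _),
    coeff_mul, Nat.sum_antidiagonal_eq_sum_range_succ_mk, sum_div]
  refine sum_congr rfl fun i hi => ?_
  have hi' : i ≤ l := by simpa [Nat.lt_succ_iff] using hi
  rw [iteratedDeriv_const_mul_field, iteratedDeriv_one_add_mul_rpow, iteratedDeriv_one_add_mul_rpow,
    coeff_mk, coeff_mk, smoothCoeff]
  have hc : ((l.choose i : ℕ) : ℝ) * i.factorial * (l - i).factorial = l.factorial := by
    exact_mod_cast Nat.choose_mul_factorial_mul_factorial hi'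
  have hl : (l.factorial : ℝ) ≠ 0 := by positivity
  rw [div_eq_iff hl, ← hc]
  simp only [neg_neg, one_pow, mul_one]
  ring

theorem kappa_eq_sum {α : ℝ} (h1 : 1 < α) (n : ℕ) :
    kappa α n = ∑ p ∈ antidiagonal n, smoothCoeff α p.1 * binCoeff (-α) p.2 := by
  have := congrArg (coeff n) (mk_kappa h1)
  simpa [coeff_mul] using this

/-- The three-term recurrence of the coefficients. -/
theorem kappa_recurrence {α : ℝ} (h1 : 1 < α) (n : ℕ) :
    ((n : ℝ) + 2) * kappa α (n + 2) =
      (1 - smoothRatio α) * (n + 1 - α) * kappa α (n + 1) +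
        smoothRatio α * (n - 2 * α) * kappa α n := by
  set ρ := smoothRatio α with hρ
  -- Each factor satisfies a first-order linear differential equation. Their combination by
  -- Leibniz's rule, read coefficientwise, is the recurrence.
  have hB : (1 - X) * d⁄dX ℝ (PowerSeries.mk (binCoeff (-α))) =
      C (-α) * PowerSeries.mk (binCoeff (-α)) := by
    ext n
    rw [sub_mul, one_mul, map_sub, coeff_C_mul, coeff_mk]
    cases n with
    | zero => simp [coeff_derivative, binCoeff_succ]
    | succ n =>
      rw [coeff_succ_X_mul, coeff_derivative, coeff_derivative, coeff_mk, coeff_mk]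
      have := succ_mul_binCoeff_succ (-α) (n + 1)
      push_cast at this ⊢
      linear_combination this
  have hQ : (1 + C ρ * X) * d⁄dX ℝ (PowerSeries.mk (smoothCoeff α)) =
      C (α * ρ) * PowerSeries.mk (smoothCoeff α) := by
    ext n
    rw [add_mul, one_mul, map_add, coeff_C_mul, coeff_mk, mul_assoc, coeff_C_mul]
    cases n with
    | zero => simp [coeff_derivative, binCoeff_succ, smoothCoeff]; ring
    | succ n =>
      rw [coeff_succ_X_mul, coeff_derivative, coeff_derivative, coeff_mk, coeff_mk]
      have := succ_mul_binCoeff_succ (-α) (n + 1)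
      simp only [smoothCoeff]
      push_cast at this ⊢
      rw [← hρ]
      linear_combination (leadCoeff α ^ α * (-ρ) ^ (n + 2)) * this
  have hK : (1 - X) * (1 + C ρ * X) * d⁄dX ℝ (PowerSeries.mk (kappa α)) =
      (C (α * ρ) * (1 - X) + C (-α) * (1 + C ρ * X)) * PowerSeries.mk (kappa α) := by
    rw [mk_kappa h1, Derivation.leibniz, smul_eq_mul, smul_eq_mul]
    linear_combination ((1 + C ρ * X) * PowerSeries.mk (smoothCoeff α)) * hB +
      ((1 - X) * PowerSeries.mk (binCoeff (-α))) * hQ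
  have hK' : d⁄dX ℝ (PowerSeries.mk (kappa α)) + C (ρ - 1) * (X * d⁄dX ℝ (PowerSeries.mk (kappa α)))
      - C ρ * (X * (X * d⁄dX ℝ (PowerSeries.mk (kappa α)))) =
      C (α * ρ - α) * PowerSeries.mk (kappa α) -
        C (2 * α * ρ) * (X * PowerSeries.mk (kappa α)) := by
    simp only [map_sub, map_mul, map_neg, map_one, map_ofNat] at hK ⊢
    linear_combination hK
  have := congrArg (coeff (n + 1)) hK'
  cases n with
  | zero =>
    simp only [map_sub, sub_mul, map_add, coeff_C_mul, coeff_succ_X_mul, coeff_derivative, coeff_mk,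
      coeff_zero_X_mul] at this
    push_cast at this ⊢
    linear_combination this
  | succ n =>
    simp only [map_sub, sub_mul, map_add, coeff_C_mul, coeff_succ_X_mul, coeff_derivative, coeff_mk] at this
    push_cast at this ⊢
    linear_combination this

end RieszScheme

end

/-! ### Moments and summability of the coefficients -/

section

open Filter Topology Finset PowerSeries

namespace RieszScheme

theorem ring_choose_eq_binCoeff (a : ℝ) (n : ℕ) :
    Ring.choose a n = binCoeff (-a) n * (-1) ^ n := by
  rw [Ring.choose_eq_smul]
  induction n with
  | zero => simp
  | succ n ih =>
    have h1 := succ_mul_binCoeff_succ (-a) n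
    have hn : ((n.factorial : ℕ) : ℝ) ≠ 0 := by positivity
    have hn1 : (n : ℝ) + 1 ≠ 0 := by positivity
    rw [smul_eq_mul, inv_mul_eq_iff_eq_mul₀ hn] at ih
    rw [descPochhammer_succ_right, mul_comm, Polynomial.smeval_mul, ih, Nat.factorial_succ]
    rw [smul_eq_mul, inv_mul_eq_iff_eq_mul₀ (by positivity)]
    simp [Polynomial.smeval_sub, Polynomial.smeval_natCast]
    linear_combination ((n.factorial : ℝ) * (-1) ^ n) * h1

theorem hasSum_binCoeff_mul_pow (a : ℝ) {x : ℝ} (hx : |x| < 1) :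
    HasSum (fun n => binCoeff (-a) n * (-x) ^ n) ((1 + x) ^ a) := by
  have h := (Real.one_add_rpow_hasFPowerSeriesOnBall_zero (a := a)).hasSum (y := x)
    (by rw [← ENNReal.ofReal_one, Metric.eball_ofReal]; simpa using hx)
  simp only [zero_add, binomialSeries_apply, ring_choose_eq_binCoeff, List.ofFn_const,
    List.prod_replicate, smul_eq_mul] at h
  refine h.congr_fun fun n => ?_
  rw [neg_pow x]
  ring

section

variable {α : ℝ}

theorem hasSum_smoothCoeff (h1 : 1 < α) (h2 : α < 2) : HasSum (smoothCoeff α) 1 := by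
  have hρ := smoothRatio_pos h1 h2
  have h := (hasSum_binCoeff_mul_pow α (x := smoothRatio α)
    (by rw [abs_of_pos hρ]; exact smoothRatio_lt_one h1)).mul_left (leadCoeff α ^ α)
  rwa [← Real.mul_rpow (leadCoeff_pos h1).le (by linarith), leadCoeff_mul h1, Real.one_rpow] at h

/-- The derivative of `(A (1 + ρ z))^α` at `z = 1` is `α A ρ = 1 - α/2`. This mean, together with
the shift by one node, produces second order. -/
theorem hasSum_mul_smoothCoeff (h1 : 1 < α) (h2 : α < 2) :
    HasSum (fun l : ℕ => (l : ℝ) * smoothCoeff α l) (1 - α / 2) := by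
  have hρ := smoothRatio_pos h1 h2
  have hA := leadCoeff_pos h1
  have h := (hasSum_binCoeff_mul_pow (α - 1) (x := smoothRatio α)
    (by rw [abs_of_pos hρ]; exact smoothRatio_lt_one h1)).mul_left
      (leadCoeff α ^ α * (α * smoothRatio α))
  rw [← hasSum_nat_add_iff' 1]
  have hval : leadCoeff α ^ α * (α * smoothRatio α) * (1 + smoothRatio α) ^ (α - 1) =
      1 - α / 2 - ∑ i ∈ range 1, ((i : ℕ) : ℝ) * smoothCoeff α i := by
    have e1 : leadCoeff α ^ α = leadCoeff α * leadCoeff α ^ (α - 1) := by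
      rw [Real.rpow_sub hA, Real.rpow_one]; field_simp
    have e2 : leadCoeff α ^ (α - 1) * (1 + smoothRatio α) ^ (α - 1) = 1 := by
      rw [← Real.mul_rpow hA.le (by linarith), leadCoeff_mul h1, Real.one_rpow]
    have e3 : leadCoeff α * (α * smoothRatio α) = 1 - α / 2 := by
      have : 3 * α - 2 ≠ 0 := by linarith
      unfold leadCoeff smoothRatio
      field_simp
    rw [e1]
    simp only [range_one, sum_singleton, Nat.cast_zero, zero_mul, sub_zero]
    linear_combination (leadCoeff α * (α * smoothRatio α)) * e2 + e3
  rw [hval] at h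
  refine h.congr_fun fun n => ?_
  have h3 := succ_mul_binCoeff_succ' (-α) n
  rw [smoothCoeff, show -(α - 1) = -α + 1 by ring]
  push_cast
  linear_combination (leadCoeff α ^ α * (-smoothRatio α) ^ (n + 1)) * h3

theorem abs_binCoeff_neg_le (h1 : 1 < α) (h2 : α < 2) (n : ℕ) : |binCoeff (-α) n| ≤ 2 := by
  have key : ∀ n, |binCoeff (-α) (n + 1)| ≤ 2 := by
    intro n
    induction n with
    | zero => simp [binCoeff_succ]; rw [abs_of_pos] <;> linarith
    | succ n ih =>
      rw [binCoeff_succ, abs_mul]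
      have : |(-α + ((n + 1 : ℕ) : ℝ)) / (((n + 1 : ℕ) : ℝ) + 1)| ≤ 1 := by
        have hn : (0 : ℝ) ≤ n := n.cast_nonneg
        push_cast
        rw [abs_div, abs_of_pos (by positivity : (0 : ℝ) < n + 1 + 1), div_le_one (by positivity),
          abs_le]
        constructor <;> linarith
      calc _ ≤ |binCoeff (-α) (n + 1)| * 1 := by gcongr
        _ ≤ 2 := by linarith
  cases n with
  | zero => simp
  | succ n => exact key n

theorem abs_smoothCoeff_le (h1 : 1 < α) (h2 : α < 2) (l : ℕ) :
    |smoothCoeff α l| ≤ 2 * smoothRatio α ^ l := by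
  have hρ := smoothRatio_pos h1 h2
  have hA := leadCoeff_pos h1
  have hA1 : leadCoeff α ^ α ≤ 1 :=
    Real.rpow_le_one hA.le (leadCoeff_lt_one h1 h2).le (by linarith)
  rw [smoothCoeff, abs_mul, abs_mul, abs_pow, abs_neg, abs_of_pos hρ,
    abs_of_pos (by positivity : 0 < leadCoeff α ^ α)]
  calc _ ≤ 1 * (2 * smoothRatio α ^ l) := by
        gcongr
        exact abs_binCoeff_neg_le h1 h2 l
    _ = _ := one_mul _

/-- The coefficients decay like `ρ^l`. The cube is the remainder of the later discrete Taylor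
expansion, whose shifts reach `l + 4`. -/
theorem summable_cube_mul_smoothCoeff (h1 : 1 < α) (h2 : α < 2) :
    Summable fun l : ℕ => ((l : ℝ) + 4) ^ 3 * |smoothCoeff α l| := by
  have hρ := smoothRatio_pos h1 h2
  have hn : ‖smoothRatio α‖ < 1 := by
    rw [Real.norm_of_nonneg hρ.le]; exact smoothRatio_lt_one h1
  -- Here `250 = 125 * 2`: 125 from `l + 4 ≤ 5 l` for `l ≥ 1`, and 2 from `abs_smoothCoeff_le`.
  have s3 := (summable_pow_mul_geometric_of_norm_lt_one 3 hn).mul_left 250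
  have s0 := (summable_pow_mul_geometric_of_norm_lt_one 0 hn).mul_left 250
  refine Summable.of_nonneg_of_le (fun l => by positivity) (fun l => ?_) (s3.add s0)
  have h := abs_smoothCoeff_le h1 h2 l
  have hl : ((l : ℝ) + 4) ^ 3 ≤ 125 * ((l : ℝ) ^ 3 + 1) := by
    rcases Nat.eq_zero_or_pos l with rfl | hl
    · norm_num
    · have : (1 : ℝ) ≤ l := by exact_mod_cast hl
      have : ((l : ℝ) + 4) ^ 3 ≤ (5 * l) ^ 3 := by gcongr; linarith
      nlinarith
  calc _ ≤ 125 * ((l : ℝ) ^ 3 + 1) * (2 * smoothRatio α ^ l) := by gcongr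
    _ = _ := by simp; ring

end

theorem exists_binCoeff_le {γ : ℝ} (h0 : 0 < γ) (h1 : γ < 1) :
    ∃ C : ℝ, 0 < C ∧ ∀ n : ℕ, binCoeff γ n ≤ C * ((n : ℝ) + 1) ^ (γ - 1) := by
  obtain ⟨C, hC, h⟩ := exists_abs_Gamma_mul_binCoeff_sub_le h0 (by linarith)
  have hΓ := Real.Gamma_pos_of_pos h0
  refine ⟨(C + (γ / 2) ^ (γ - 1)) / Real.Gamma γ, by positivity, fun n => ?_⟩
  have hn : (0 : ℝ) ≤ n := n.cast_nonneg
  have a1 := (abs_le.1 (h n)).2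
  have a2 : ((n : ℝ) + γ / 2) ^ (γ - 1) ≤ (γ / 2) ^ (γ - 1) * ((n : ℝ) + 1) ^ (γ - 1) := by
    rw [← Real.mul_rpow (by positivity) (by positivity)]
    apply Real.rpow_le_rpow_of_nonpos (by positivity) (by nlinarith) (by linarith)
  have a3 : ((n : ℝ) + 1) ^ (γ - 3) ≤ ((n : ℝ) + 1) ^ (γ - 1) :=
    Real.rpow_le_rpow_of_exponent_le (by linarith) (by linarith)
  have a4 : C * ((n : ℝ) + 1) ^ (γ - 3) ≤ C * ((n : ℝ) + 1) ^ (γ - 1) := by gcongr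
  rw [div_mul_eq_mul_div, le_div_iff₀ hΓ]
  linarith

theorem tendsto_binCoeff_zero {γ : ℝ} (h0 : 0 < γ) (h1 : γ < 1) :
    Tendsto (binCoeff γ) atTop (𝓝 0) := by
  obtain ⟨C, hC, h⟩ := exists_binCoeff_le h0 h1
  have h2 : Tendsto (fun n : ℕ => C * ((n : ℝ) + 1) ^ (γ - 1)) atTop (𝓝 0) := by
    have := ((tendsto_rpow_neg_atTop (y := 1 - γ) (by linarith)).comp
      (tendsto_atTop_add_const_right _ (1 : ℝ) tendsto_natCast_atTop_atTop)).const_mul C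
    simpa [Function.comp_def] using this
  exact squeeze_zero (fun n => (binCoeff_pos h0 n).le) h h2

section

variable {α : ℝ}

/-- The partial sums are `binCoeff (1 - α)`, themselves differences of `binCoeff (2 - α)`, which
tends to zero. Since the terms are nonnegative from index 2 on, convergence of partial sums is
summability. -/
theorem hasSum_binCoeff_neg (h1 : 1 < α) (h2 : α < 2) : HasSum (binCoeff (-α)) 0 := by
  have hpart : ∀ n, ∑ i ∈ range (n + 1), binCoeff (-α) i = binCoeff (1 - α) n := by
    intro n
    induction n with
    | zero => simp
    | succ n ih =>
      rw [sum_range_succ, ih]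
      have := binCoeff_succ_sub (-α) n
      rw [show -α + 1 = 1 - α by ring] at this
      linarith
  have hlim : Tendsto (fun n => ∑ i ∈ range n, binCoeff (-α) i) atTop (𝓝 0) := by
    rw [← tendsto_add_atTop_iff_nat 2]
    have h0 := tendsto_binCoeff_zero (γ := 2 - α) (by linarith) (by linarith)
    have h3 := ((tendsto_add_atTop_iff_nat 1).2 h0).sub h0
    rw [sub_zero] at h3
    refine h3.congr fun n => ?_
    rw [hpart (n + 1)]
    have := binCoeff_succ_sub (1 - α) n
    rw [show 1 - α + 1 = 2 - α by ring] at this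
    exact this
  have hnn : ∀ n, 0 ≤ binCoeff (-α) (n + 2) := by
    intro n
    induction n with
    | zero => simp [binCoeff_succ]; nlinarith
    | succ n ih =>
      rw [binCoeff_succ]
      refine mul_nonneg ih (div_nonneg ?_ (by positivity))
      push_cast
      have : (0 : ℝ) ≤ n := n.cast_nonneg
      linarith
  rw [← hasSum_nat_add_iff' 2, hasSum_iff_tendsto_nat_of_nonneg hnn]
  have h4 := ((tendsto_add_atTop_iff_nat 2).2 hlim).sub_const
    (∑ i ∈ range 2, binCoeff (-α) i)
  refine h4.congr fun n => ?_
  rw [add_comm n 2, sum_range_add]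
  simp [add_comm]

/-- The generating function vanishes at `z = 1`: Cauchy product of sums 1 and 0. -/
theorem hasSum_kappa (h1 : 1 < α) (h2 : α < 2) : HasSum (kappa α) 0 := by
  have hf : Summable fun x => ‖smoothCoeff α x‖ := (hasSum_smoothCoeff h1 h2).summable.norm
  have hg : Summable fun x => ‖binCoeff (-α) x‖ := (hasSum_binCoeff_neg h1 h2).summable.norm
  have h3 := tsum_mul_tsum_eq_tsum_sum_antidiagonal_of_summable_norm hf hg
  have h4 := (summable_norm_sum_mul_antidiagonal_of_summable_norm hf hg).of_norm
  rw [(hasSum_binCoeff_neg h1 h2).tsum_eq, mul_zero] at h3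
  have h5 := h4.hasSum
  rw [← h3] at h5
  exact h5.congr_fun (fun n => kappa_eq_sum h1 n) 

end

end RieszScheme

end

/-! ### Signs of the coefficients and stability -/

section

open Filter Topology Finset

namespace RieszScheme

section

variable {α : ℝ}

theorem kappa_zero (h1 : 1 < α) : kappa α 0 = leadCoeff α ^ α := by
  simp [kappa_eq_sum h1, smoothCoeff]

theorem kappa_one (h1 : 1 < α) :
    kappa α 1 = -(leadCoeff α ^ α * (4 * α * (α - 1) / (3 * α - 2))) := by
  have e1 : 3 * α - 2 ≠ 0 := by linarith
  rw [kappa_eq_sum h1, Nat.sum_antidiagonal_eq_sum_range_succ_mk]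
  simp only [sum_range_succ, range_zero, sum_empty, smoothCoeff, binCoeff_succ, binCoeff_zero,
    smoothRatio]
  norm_num
  generalize leadCoeff α ^ α = A
  generalize hq : 3 * α - 2 = q at e1 ⊢
  obtain rfl : α = (q + 2) / 3 := by linarith
  field_simp
  ring

theorem kappa_two (h1 : 1 < α) :
    kappa α 2 = leadCoeff α ^ α * (α / (3 * α - 2) ^ 2 *
      (8 * (α - 1) ^ 3 + 3 * (α - 1) ^ 2 - 2 * (α - 1) - 1)) := by
  have e1 : 3 * α - 2 ≠ 0 := by linarith
  have h := kappa_recurrence h1 0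
  norm_num [kappa_zero h1, kappa_one h1, smoothRatio] at h
  rw [← mul_right_inj' (two_ne_zero (α := ℝ)), h]
  generalize leadCoeff α ^ α = A
  generalize hq : 3 * α - 2 = q at e1 ⊢
  obtain rfl : α = (q + 2) / 3 := by linarith
  field_simp
  ring

/-- Powers of `α - 1` and `2 - α`, both positive, make the sign visible; likewise for the next two
coefficients. -/
theorem kappa_three (h1 : 1 < α) :
    kappa α 3 = leadCoeff α ^ α * (4 / 3 * (α - 1) ^ 2 * (2 - α) * α / (3 * α - 2) ^ 3 *
      (8 * (α - 1) ^ 2 + 9 * (α - 1) + 3)) := by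
  have e1 : 3 * α - 2 ≠ 0 := by linarith
  have h := kappa_recurrence h1 1
  norm_num [kappa_two h1, kappa_one h1, smoothRatio] at h
  rw [← mul_right_inj' (three_ne_zero (α := ℝ)), h]
  generalize leadCoeff α ^ α = A
  generalize hq : 3 * α - 2 = q at e1 ⊢
  obtain rfl : α = (q + 2) / 3 := by linarith
  field_simp
  ring

theorem kappa_four (h1 : 1 < α) :
    kappa α 4 = leadCoeff α ^ α * (1 / 6 * (α - 1) * (2 - α) * α / (3 * α - 2) ^ 4 *
      (-64 * (α - 1) ^ 5 - 16 * (α - 1) ^ 4 + 69 * (α - 1) ^ 3 + 57 * (α - 1) ^ 2 +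
        15 * (α - 1) + 3)) := by
  have e1 : 3 * α - 2 ≠ 0 := by linarith
  have h := kappa_recurrence h1 2
  norm_num [kappa_three h1, kappa_two h1, smoothRatio] at h
  rw [← mul_right_inj' (four_ne_zero (α := ℝ)), h]
  generalize leadCoeff α ^ α = A
  generalize hq : 3 * α - 2 = q at e1 ⊢
  obtain rfl : α = (q + 2) / 3 := by linarith
  field_simp
  ring

theorem kappa_five (h1 : 1 < α) :
    kappa α 5 = leadCoeff α ^ α * (2 / 15 * (α - 1) ^ 2 * (2 - α) * α / (3 * α - 2) ^ 5 *
      ((4 - α) * (-64 * (α - 1) ^ 5 - 16 * (α - 1) ^ 4 + 69 * (α - 1) ^ 3 + 57 * (α - 1) ^ 2 +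
        15 * (α - 1) + 3) +
        2 * (2 - α) * (3 - 2 * α) * (8 * (α - 1) ^ 2 + 9 * (α - 1) + 3) * (3 * α - 2))) := by
  have e1 : 3 * α - 2 ≠ 0 := by linarith
  have h := kappa_recurrence h1 3
  norm_num [kappa_four h1, kappa_three h1, smoothRatio] at h
  rw [← mul_right_inj' (by norm_num : (5 : ℝ) ≠ 0), h]
  generalize leadCoeff α ^ α = A
  generalize hq : 3 * α - 2 = q at e1 ⊢
  obtain rfl : α = (q + 2) / 3 := by linarith
  field_simp
  ring

/-- For `α` near 1, `κ_2` is negative. The sum suffices because these two coefficients multiply the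
same correlation in the quadratic form. -/
theorem kappa_zero_add_kappa_two_nonneg (h1 : 1 < α) : 0 ≤ kappa α 0 + kappa α 2 := by
  have hA := leadCoeff_pos h1
  have hq : 0 < 3 * α - 2 := by linarith
  obtain ⟨s, hs, rfl⟩ : ∃ s, 0 < s ∧ α = 1 + s := ⟨α - 1, by linarith, by ring⟩
  have : kappa (1 + s) 0 + kappa (1 + s) 2 = leadCoeff (1 + s) ^ (1 + s) *
      ((3 * s + 10 * s ^ 2 + 11 * s ^ 3 + 8 * s ^ 4) / (3 * (1 + s) - 2) ^ 2) := by
    rw [kappa_zero h1, kappa_two h1]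
    generalize leadCoeff (1 + s) ^ (1 + s) = A
    generalize hq' : 3 * (1 + s) - 2 = q at hq ⊢
    obtain rfl : s = (q - 1) / 3 := by linarith
    field_simp
    ring
  rw [this]
  positivity

/-- The recurrence preserves signs once `n ≥ 2α`, in particular for `n ≥ 4`. This leaves indices 3,
4 and 5 to the explicit formulas. -/
theorem kappa_nonneg (h1 : 1 < α) (h2 : α < 2) (n : ℕ) : 0 ≤ kappa α (n + 3) := by
  have hA := leadCoeff_pos h1
  have hq : 0 < 3 * α - 2 := by linarith
  have hs0 : 0 < α - 1 := by linarith
  have hs1 : 0 < 2 - α := by linarith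
  have hp4 : 5 * (α - 1) ^ 3 + 41 * (α - 1) ^ 2 + 15 * (α - 1) + 3 ≤
      -64 * (α - 1) ^ 5 - 16 * (α - 1) ^ 4 + 69 * (α - 1) ^ 3 + 57 * (α - 1) ^ 2 +
        15 * (α - 1) + 3 := by
    have e1 : (α - 1) ^ 5 ≤ (α - 1) ^ 3 :=
      pow_le_pow_of_le_one hs0.le (by linarith) (by norm_num)
    have e2 : (α - 1) ^ 4 ≤ (α - 1) ^ 2 :=
      pow_le_pow_of_le_one hs0.le (by linarith) (by norm_num)
    linarith
  have hp4' : 0 < 5 * (α - 1) ^ 3 + 41 * (α - 1) ^ 2 + 15 * (α - 1) + 3 := by positivity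
  have k3 : 0 ≤ kappa α 3 := by rw [kappa_three h1]; positivity
  have k4 : 0 ≤ kappa α 4 := by
    rw [kappa_four h1]
    have := hp4'.le.trans hp4
    positivity
  have k5 : 0 ≤ kappa α 5 := by
    rw [kappa_five h1]
    refine mul_nonneg (by positivity) (mul_nonneg (by positivity) ?_)
    set s := α - 1 with hs
    have hα : α = 1 + s := by rw [hs]; ring
    rw [hα] at hs1 ⊢
    set p := -64 * s ^ 5 - 16 * s ^ 4 + 69 * s ^ 3 + 57 * s ^ 2 + 15 * s + 3
    have e1 : 2 * (5 * s ^ 3 + 41 * s ^ 2 + 15 * s + 3) ≤ (4 - (1 + s)) * p := by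
      apply mul_le_mul (by linarith) hp4 hp4'.le (by linarith)
    -- The factor `(1 - s)(1 - 2s)` is negative for `α > 3/2`, but its minimum, attained at `s =
    -- 3/4`, is absorbed by the first term.
    have e2 : -(1 / 8) ≤ (2 - (1 + s)) * (3 - 2 * (1 + s)) := by
      nlinarith [sq_nonneg (s - 3 / 4)]
    have e3 : -(1 / 8) * (2 * (8 * s ^ 2 + 9 * s + 3) * (3 * (1 + s) - 2)) ≤
        (2 - (1 + s)) * (3 - 2 * (1 + s)) * (2 * (8 * s ^ 2 + 9 * s + 3) * (3 * (1 + s) - 2)) := by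
      apply mul_le_mul_of_nonneg_right e2
      have : 0 < 3 * (1 + s) - 2 := by linarith
      positivity
    nlinarith [pow_pos hs0 3, pow_pos hs0 2]
  have key : ∀ n, 0 ≤ kappa α (n + 4) ∧ 0 ≤ kappa α (n + 5) := by
    intro n
    induction n with
    | zero => exact ⟨k4, k5⟩
    | succ n ih =>
      refine ⟨ih.2, ?_⟩
      have h := kappa_recurrence h1 (n + 4)
      have hn : (0 : ℝ) ≤ n := n.cast_nonneg
      have hρ := smoothRatio_pos h1 h2
      have hρ1 := smoothRatio_lt_one h1
      push_cast at h
      have t1 : 0 ≤ (1 - smoothRatio α) * ((n : ℝ) + 4 + 1 - α) * kappa α (n + 4 + 1) :=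
        mul_nonneg (mul_nonneg (by linarith) (by linarith)) ih.2
      have t2 : 0 ≤ smoothRatio α * ((n : ℝ) + 4 - 2 * α) * kappa α (n + 4) :=
        mul_nonneg (mul_nonneg hρ.le (by linarith)) ih.1
      have t3 : 0 ≤ ((n : ℝ) + 4 + 2) * kappa α (n + 4 + 2) := by rw [h]; linarith
      exact nonneg_of_mul_nonneg_right t3 (by linarith)
  cases n with
  | zero => exact k3
  | succ n => exact (key n).1

/-- The full sum is zero and the omitted tail is nonnegative. -/
theorem sum_kappa_nonpos (h1 : 1 < α) (h2 : α < 2) {n : ℕ} (hn : 3 ≤ n) :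
    ∑ l ∈ range n, kappa α l ≤ 0 := by
  refine sum_le_hasSum (range n) (fun i hi => ?_) (hasSum_kappa h1 h2)
  obtain ⟨m, rfl⟩ : ∃ m, i = m + 3 := ⟨i - 3, by simp at hi; omega⟩
  exact kappa_nonneg h1 h2 m

theorem rieszConst_pos (h1 : 1 < α) (h2 : α < 2) : 0 < rieszConst α := by
  have : Real.cos (Real.pi / 2 * α) < 0 := by
    apply Real.cos_neg_of_pi_div_two_lt_of_lt <;> nlinarith [Real.pi_pos]
  unfold rieszConst
  apply div_pos_of_neg_of_neg <;> linarith

end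

/-! The quadratic forms of the difference operators. -/

theorem sum_shift_mul_le (M m : ℕ) (v : ℕ → ℝ) :
    ∑ i ∈ range (M - m), v (i + m) * v i ≤ ∑ i ∈ range M, v i ^ 2 := by
  have h1 : ∑ i ∈ range (M - m), v i ^ 2 ≤ ∑ i ∈ range M, v i ^ 2 :=
    sum_le_sum_of_subset_of_nonneg (range_mono (Nat.sub_le M m)) fun _ _ _ => sq_nonneg _
  have h2 : ∑ i ∈ range (M - m), v (i + m) ^ 2 ≤ ∑ i ∈ range M, v i ^ 2 := by
    rcases le_or_gt m M with h | h
    · have : ∑ i ∈ range M, v i ^ 2 =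
          ∑ i ∈ range m, v i ^ 2 + ∑ i ∈ range (M - m), v (m + i) ^ 2 := by
        rw [← sum_range_add, Nat.add_sub_cancel' h]
      rw [this]
      simp only [add_comm m]
      have : 0 ≤ ∑ i ∈ range m, v i ^ 2 := sum_nonneg fun _ _ => sq_nonneg _
      linarith
    · rw [Nat.sub_eq_zero_of_le h.le]
      simpa using sum_nonneg fun i (_ : i ∈ range M) => sq_nonneg (v i)
  have h3 : ∑ i ∈ range (M - m), v (i + m) * v i ≤
      ∑ i ∈ range (M - m), (v (i + m) ^ 2 + v i ^ 2) / 2 :=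
    sum_le_sum fun i _ => by nlinarith [sq_nonneg (v (i + m) - v i)]
  rw [← sum_div, sum_add_distrib] at h3
  linarith

theorem sum_Icc_eq_sum_range_of_zero {M : ℕ} {g : ℕ → ℝ} (h0 : g 0 = 0) :
    ∑ j ∈ Icc 1 (M - 1), g j = ∑ j ∈ range M, g j := by
  refine sum_subset (fun j hj => ?_) (fun j hj hj' => ?_)
  · simp at hj ⊢; omega
  · obtain rfl : j = 0 := by simp at hj hj'; omega
    exact h0

theorem sum_mul_leftOp_nonpos {α h : ℝ} (h1 : 1 < α) (h2 : α < 2) (hh : 0 < h) {M : ℕ}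
    {v : ℕ → ℝ} (v0 : v 0 = 0) (vM : v M = 0) :
    ∑ j ∈ Icc 1 (M - 1), v j * leftOp α h v j ≤ 0 := by
  rcases Nat.lt_or_ge M 2 with hM | hM
  · rw [Icc_eq_empty (by omega)]; simp
  rw [sum_Icc_eq_sum_range_of_zero (by simp [v0])]
  set S := ∑ i ∈ range M, v i ^ 2 with hS
  have hS0 : 0 ≤ S := sum_nonneg fun _ _ => sq_nonneg _
  -- correlation of `v` with its shift
  set T : ℕ → ℝ := fun l => ∑ j ∈ range M, if l ≤ j + 1 then v j * v (j + 1 - l) else 0 with hT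
  have hT1 : ∀ m, T (m + 1) = ∑ i ∈ range (M - m), v (i + m) * v i := by
    intro m
    simp only [hT, add_le_add_iff_right, Nat.add_sub_add_right]
    rcases le_or_gt m M with h | h
    · rw [← Nat.add_sub_cancel' h, sum_range_add, sum_eq_zero, zero_add, Nat.add_sub_cancel_left]
      · refine sum_congr rfl fun i _ => ?_
        rw [if_pos (by omega), Nat.add_sub_cancel_left, add_comm]
      · intro i hi
        rw [if_neg (by simpa using hi)]
    · rw [Nat.sub_eq_zero_of_le h.le, range_zero, sum_empty]
      exact sum_eq_zero fun i hi => if_neg (by have := mem_range.1 hi; omega)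
  -- Shifts by one node forwards and backwards have the same correlation; the term reaching node `M`
  -- drops out by the boundary value.
  have hT0 : T 0 = T 2 := by
    rw [hT1 1]
    obtain ⟨k, rfl⟩ : ∃ k, M = k + 1 := ⟨M - 1, by omega⟩
    simp only [hT, Nat.zero_le, if_true, Nat.sub_zero, Nat.add_sub_cancel]
    rw [sum_range_succ, vM, mul_zero, add_zero]
    exact sum_congr rfl fun i _ => mul_comm _ _
  have hTle : ∀ m, T (m + 1) ≤ S := fun m => by rw [hT1]; exact sum_shift_mul_le M m v
  have hT1S : T 1 = S := by
    rw [hT1 0, hS]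
    exact sum_congr rfl fun i _ => by rw [add_zero, pow_two]
  have hsum : ∑ j ∈ range M, v j * leftOp α h v j =
      1 / h ^ α * ∑ l ∈ range (M + 1), kappa α l * T l := by
    simp only [hT, mul_sum]
    rw [sum_comm]
    refine sum_congr rfl fun j hj => ?_
    have hj' := mem_range.1 hj
    rw [leftOp, mul_sum, mul_sum]
    have : range (j + 2) ⊆ range (M + 1) := range_mono (by omega)
    rw [← sum_subset this]
    · refine sum_congr rfl fun l hl => ?_
      rw [if_pos (by have := mem_range.1 hl; omega)]
      ring
    · intro l _ hl
      rw [if_neg (by simp at hl; omega)]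
      simp
  rw [hsum]
  refine mul_nonpos_of_nonneg_of_nonpos (by positivity) ?_
  -- The negative `κ_1` does no harm because `T 1 = S` exactly; indices 0 and 2 are estimated
  -- together.
  have hle : ∑ l ∈ range (M + 1), kappa α l * T l ≤ ∑ l ∈ range (M + 1), kappa α l * S := by
    obtain ⟨k, rfl⟩ : ∃ k, M = k + 2 := ⟨M - 2, by omega⟩
    rw [show k + 2 + 1 = 3 + k by ring, sum_range_add, sum_range_add]
    have a1 : ∑ l ∈ range k, kappa α (3 + l) * T (3 + l) ≤
        ∑ l ∈ range k, kappa α (3 + l) * S := by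
      refine sum_le_sum fun l _ => ?_
      have := kappa_nonneg h1 h2 l
      rw [add_comm 3 l]
      exact mul_le_mul_of_nonneg_left (hTle (l + 2)) this
    have a2 : ∑ l ∈ range 3, kappa α l * T l ≤ ∑ l ∈ range 3, kappa α l * S := by
      simp only [sum_range_succ, range_zero, sum_empty, hT0, hT1S]
      have := mul_le_mul_of_nonneg_left (hTle 1) (kappa_zero_add_kappa_two_nonneg h1)
      norm_num at this ⊢
      linarith
    linarith
  refine hle.trans ?_
  rw [← sum_mul]
  exact mul_nonpos_of_nonpos_of_nonneg (sum_kappa_nonpos h1 h2 (by omega)) hS0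

/-- Reflection of the grid. For `1 ≤ j` the index `j + l - 1` is not truncated. -/
theorem rightOp_eq_leftOp_reverse {α h : ℝ} {M j : ℕ} (hj : 1 ≤ j) (v : ℕ → ℝ) (hjM : j ≤ M) :
    rightOp α h M v j = leftOp α h (fun i => v (M - i)) (M - j) := by
  rw [rightOp, leftOp]
  congr 1
  refine sum_congr rfl fun l hl => ?_
  have := mem_range.1 hl
  congr 2
  omega

theorem sum_Icc_reverse (M : ℕ) (g : ℕ → ℝ) :
    ∑ j ∈ Icc 1 (M - 1), g (M - j) = ∑ j ∈ Icc 1 (M - 1), g j := by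
  refine sum_nbij' (fun j => M - j) (fun j => M - j) ?_ ?_ ?_ ?_ ?_ <;> intro j hj <;>
    simp only [mem_Icc] at hj ⊢ <;> omega

theorem sum_mul_rieszOp_nonpos {α h : ℝ} (h1 : 1 < α) (h2 : α < 2) (hh : 0 < h) {M : ℕ}
    {v : ℕ → ℝ} (v0 : v 0 = 0) (vM : v M = 0) :
    ∑ j ∈ Icc 1 (M - 1), v j * rieszOp α h M v j ≤ 0 := by
  have hl := sum_mul_leftOp_nonpos h1 h2 hh v0 vM
  have hr : ∑ j ∈ Icc 1 (M - 1), v j * rightOp α h M v j ≤ 0 := by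
    have := sum_mul_leftOp_nonpos h1 h2 hh (M := M) (v := fun i => v (M - i)) (by simpa) (by simpa)
    rw [← sum_Icc_reverse] at this
    refine le_of_eq_of_le (sum_congr rfl fun j hj => ?_) this
    simp only [mem_Icc] at hj
    rw [rightOp_eq_leftOp_reverse hj.1 v (by omega), Nat.sub_sub_self (by omega)]
  have : ∑ j ∈ Icc 1 (M - 1), v j * rieszOp α h M v j = rieszConst α *
      (∑ j ∈ Icc 1 (M - 1), v j * leftOp α h v j + ∑ j ∈ Icc 1 (M - 1), v j * rightOp α h M v j) := by
    rw [← sum_add_distrib, mul_sum]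
    exact sum_congr rfl fun j _ => by rw [rieszOp]; ring
  rw [this]
  exact mul_nonpos_of_nonneg_of_nonpos (rieszConst_pos h1 h2).le (by linarith)

theorem sum_mul_centralDiff_eq_zero {h : ℝ} {M : ℕ} {v : ℕ → ℝ} (v0 : v 0 = 0) (vM : v M = 0) :
    ∑ j ∈ Icc 1 (M - 1), v j * centralDiff h v j = 0 := by
  rcases Nat.eq_zero_or_pos M with rfl | hM
  · simp
  obtain ⟨k, rfl⟩ : ∃ k, M = k + 1 := ⟨M - 1, by omega⟩
  -- The sum telescopes. At `j = 0` truncated subtraction reads `v 0` for the predecessor, which is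
  -- harmless as `v 0 = 0`.
  have h1 : ∀ j ∈ range (k + 1), v j * centralDiff h v j =
      v (j + 1) * v j / (2 * h) - v j * v (j - 1) / (2 * h) := by
    intro j _
    rw [centralDiff, halfDiff, halfDiff, Nat.add_sub_cancel]
    rcases eq_or_ne h 0 with rfl | hh
    · simp
    · field_simp; ring
  rw [sum_Icc_eq_sum_range_of_zero (by simp [v0]), sum_congr rfl h1, sum_sub_distrib,
    sum_range_succ, sum_range_succ', vM, v0]
  simp

end RieszScheme

end

/-! ### The Peano kernel at unit step -/

section

open Filter Topology Finset PowerSeries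

namespace RieszScheme

/-- The coefficient of `x ^ n` in `x ^ l * (1 - x) ^ (-γ)`. -/
noncomputable def shiftCoeff (γ : ℝ) (n l : ℕ) : ℝ := if l ≤ n then binCoeff γ (n - l) else 0

theorem shiftCoeff_zero (γ : ℝ) (n : ℕ) : shiftCoeff γ n 0 = binCoeff γ n := by simp [shiftCoeff]

/-- Differences in the shift lower `γ`; extension by zero keeps this valid for `l ≥ n`, so Taylor
expansion in `l` needs no case distinction. -/
theorem shiftCoeff_sub_succ (γ : ℝ) (n l : ℕ) :
    shiftCoeff (γ + 1) n l - shiftCoeff (γ + 1) n (l + 1) = shiftCoeff γ n l := by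
  unfold shiftCoeff
  rcases lt_trichotomy l n with h | rfl | h
  · obtain ⟨k, rfl⟩ : ∃ k, n = l + (k + 1) := ⟨n - l - 1, by omega⟩
    rw [if_pos (by omega), if_pos (by omega), if_pos (by omega), Nat.add_sub_cancel_left,
      show l + (k + 1) - (l + 1) = k by omega, binCoeff_succ_sub]
  · simp
  · rw [if_neg (by omega), if_neg (by omega), if_neg (by omega), sub_zero]

/-- Discrete second-order Taylor expansion of the coefficients of `(1 - x) ^ (-(γ + 2))`. -/
theorem exists_abs_shiftCoeff_sub_le {γ : ℝ} (h0 : 0 < γ) (h1 : γ < 1) :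
    ∃ C : ℝ, 0 < C ∧ ∀ n l : ℕ,
      |shiftCoeff (γ + 1 + 1) n l - binCoeff (γ + 1 + 1) n + l * binCoeff (γ + 1) n| ≤
        C * ((n : ℝ) + 1) ^ (γ - 1) * (l : ℝ) ^ 3 := by
  obtain ⟨C, hC, hb⟩ := exists_binCoeff_le h0 h1
  refine ⟨C, hC, fun n => ?_⟩
  set D : ℝ := C * ((n : ℝ) + 1) ^ (γ - 1) with hD
  have hD0 : 0 < D := by positivity
  -- For `n = l + k`, `(k + 1)(l + 1) ≥ n + 1` and the exponent is negative; the factor `l + 1` pays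
  -- for shifts close to `n`. Two summations over `l` then give `l²` and `l³`.
  have e0 : ∀ l : ℕ, |shiftCoeff γ n l| ≤ D * (l + 1) := by
    intro l
    unfold shiftCoeff
    split_ifs with h
    · obtain ⟨k, rfl⟩ : ∃ k, n = l + k := ⟨n - l, by omega⟩
      rw [Nat.add_sub_cancel_left, abs_of_pos (binCoeff_pos h0 k)]
      refine (hb k).trans ?_
      rw [hD, mul_assoc]
      refine mul_le_mul_of_nonneg_left ?_ hC.le
      have hk : (0 : ℝ) ≤ k := k.cast_nonneg
      have hl : (0 : ℝ) ≤ l := l.cast_nonneg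
      have t1 : (((k : ℝ) + 1) * (l + 1)) ^ (γ - 1) ≤ (((l + k : ℕ) : ℝ) + 1) ^ (γ - 1) := by
        apply Real.rpow_le_rpow_of_nonpos (by positivity) _ (by linarith)
        push_cast
        nlinarith [mul_nonneg hk hl]
      have t2 : ((l : ℝ) + 1) ^ (-1 : ℝ) ≤ ((l : ℝ) + 1) ^ (γ - 1) :=
        Real.rpow_le_rpow_of_exponent_le (by linarith) (by linarith)
      rw [Real.mul_rpow (by positivity) (by positivity)] at t1
      rw [Real.rpow_neg_one] at t2
      calc ((k : ℝ) + 1) ^ (γ - 1) = ((k : ℝ) + 1) ^ (γ - 1) * ((l : ℝ) + 1)⁻¹ * (l + 1) := by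
            field_simp
        _ ≤ ((k : ℝ) + 1) ^ (γ - 1) * ((l : ℝ) + 1) ^ (γ - 1) * (l + 1) := by gcongr
        _ ≤ _ := by gcongr
    · rw [abs_zero]; positivity
  have e1 : ∀ l : ℕ, |shiftCoeff (γ + 1) n l - binCoeff (γ + 1) n| ≤ D * (l : ℝ) ^ 2 := by
    intro l
    induction l with
    | zero => simp [shiftCoeff_zero]
    | succ l ih =>
      have h2 := shiftCoeff_sub_succ γ n l
      have h3 := e0 l
      have h4 : shiftCoeff (γ + 1) n (l + 1) - binCoeff (γ + 1) n =
        (shiftCoeff (γ + 1) n l - binCoeff (γ + 1) n) - shiftCoeff γ n l := by linarith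
      rw [h4]
      refine (abs_sub _ _).trans ((add_le_add ih h3).trans ?_)
      push_cast
      have : 0 ≤ D * l := by positivity
      nlinarith
  intro l
  induction l with
  | zero => simp [shiftCoeff_zero]
  | succ l ih =>
    have h2 := shiftCoeff_sub_succ (γ + 1) n l
    have h3 := e1 l
    have h4 : shiftCoeff (γ + 1 + 1) n (l + 1) - binCoeff (γ + 1 + 1) n +
        ((l + 1 : ℕ) : ℝ) * binCoeff (γ + 1) n =
      (shiftCoeff (γ + 1 + 1) n l - binCoeff (γ + 1 + 1) n + l * binCoeff (γ + 1) n) -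
        (shiftCoeff (γ + 1) n l - binCoeff (γ + 1) n) := by push_cast; linarith
    rw [h4]
    refine (abs_sub _ _).trans ((add_le_add ih h3).trans ?_)
    push_cast
    have : 0 ≤ D * l := by positivity
    have : 0 ≤ D * (l : ℝ) ^ 2 := by positivity
    nlinarith

section

variable {α : ℝ}

/-- The coefficient averages shifted binomial coefficients with weights `smoothCoeff α l`. The
discrete Taylor expansion sees their mass 1 and mean `1 - α/2`; the cubic remainder is summable. -/
theorem exists_abs_coeff_smooth_mul_sub_le (h1 : 1 < α) (h2 : α < 2) :
    ∃ C : ℝ, 0 < C ∧ ∀ i : ℕ, i ≤ 4 → ∀ n : ℕ,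
      |coeff n (X ^ i * (PowerSeries.mk (smoothCoeff α) * PowerSeries.mk (binCoeff (4 - α)))) -
        binCoeff (4 - α) n + (i + (1 - α / 2)) * binCoeff (3 - α) n| ≤
        C * ((n : ℝ) + 1) ^ (1 - α) := by
  obtain ⟨C, hC, hT⟩ := exists_abs_shiftCoeff_sub_le (γ := 2 - α) (by linarith) (by linarith)
  rw [show 2 - α + 1 + 1 = 4 - α by ring, show 2 - α + 1 = 3 - α by ring,
    show 2 - α - 1 = 1 - α by ring] at hT
  set B : ℝ := ∑' l : ℕ, ((l : ℝ) + 4) ^ 3 * |smoothCoeff α l| with hB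
  have hB0 : 0 ≤ B := tsum_nonneg fun l => by positivity
  refine ⟨C * (B + 1), by positivity, fun i hi n => ?_⟩
  have hi' : (i : ℝ) ≤ 4 := by exact_mod_cast hi
  set D : ℝ := C * ((n : ℝ) + 1) ^ (1 - α) with hD
  have hD0 : 0 < D := by positivity
  have hcoeff : HasSum (fun l : ℕ => smoothCoeff α l * shiftCoeff (4 - α) n (l + i))
      (coeff n (X ^ i *
        (PowerSeries.mk (smoothCoeff α) * PowerSeries.mk (binCoeff (4 - α))))) := by
    rw [coeff_X_pow_mul']
    split_ifs with hin
    · rw [coeff_mul, Nat.sum_antidiagonal_eq_sum_range_succ_mk]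
      have : ∑ k ∈ range (n - i).succ, (coeff k) (PowerSeries.mk (smoothCoeff α)) *
          (coeff (n - i - k)) (PowerSeries.mk (binCoeff (4 - α))) =
          ∑ k ∈ range (n - i).succ, smoothCoeff α k * shiftCoeff (4 - α) n (k + i) := by
        refine sum_congr rfl fun k hk => ?_
        have := mem_range.1 hk
        rw [coeff_mk, coeff_mk, shiftCoeff, if_pos (by omega), show n - i - k = n - (k + i) by omega]
      rw [this]
      refine hasSum_sum_of_ne_finset_zero fun k hk => ?_
      rw [mem_range, not_lt] at hk
      rw [shiftCoeff, if_neg (by omega), mul_zero]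
    · have : (fun l : ℕ => smoothCoeff α l * shiftCoeff (4 - α) n (l + i)) = fun _ => 0 := by
        ext l
        rw [shiftCoeff, if_neg (by omega), mul_zero]
      rw [this]
      exact hasSum_zero
  have hs0 := (hasSum_smoothCoeff h1 h2).mul_right
    (binCoeff (4 - α) n - i * binCoeff (3 - α) n)
  have hs1 := (hasSum_mul_smoothCoeff h1 h2).mul_right (binCoeff (3 - α) n)
  have hs := (hcoeff.sub hs0).add hs1
  have hval : coeff n (X ^ i *
      (PowerSeries.mk (smoothCoeff α) * PowerSeries.mk (binCoeff (4 - α)))) -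
        binCoeff (4 - α) n + (i + (1 - α / 2)) * binCoeff (3 - α) n = _ :=
    Eq.trans (by ring) hs.tsum_eq.symm
  rw [hval, ← Real.norm_eq_abs]
  refine (tsum_of_norm_bounded
    ((summable_cube_mul_smoothCoeff h1 h2).hasSum.mul_left D) fun l => ?_).trans ?_
  · have := hT n (l + i)
    rw [Real.norm_eq_abs]
    have e : smoothCoeff α l * shiftCoeff (4 - α) n (l + i) -
        smoothCoeff α l * (binCoeff (4 - α) n - i * binCoeff (3 - α) n) +
        (l : ℝ) * smoothCoeff α l * binCoeff (3 - α) n = smoothCoeff α l *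
        (shiftCoeff (4 - α) n (l + i) - binCoeff (4 - α) n +
          ((l + i : ℕ) : ℝ) * binCoeff (3 - α) n) := by push_cast; ring
    rw [e, abs_mul]
    have e2 : (((l + i : ℕ) : ℝ)) ^ 3 ≤ ((l : ℝ) + 4) ^ 3 := by
      push_cast; gcongr
    calc _ ≤ |smoothCoeff α l| * (D * ((l : ℝ) + 4) ^ 3) := by
          gcongr
          exact this.trans (by gcongr)
      _ = _ := by ring
  · rw [← hB, hD]
    have : 0 < C * ((n : ℝ) + 1) ^ (1 - α) := by positivity
    nlinarith

/-- Fourth difference of the cubes: the values of the cubic B-spline. -/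
theorem one_sub_X_pow_mul_mk_cube (θ : ℝ) :
    (1 - X) ^ 4 * PowerSeries.mk (fun m : ℕ => ((m : ℝ) + θ) ^ 3 / 6) =
      C (θ ^ 3 / 6) * X ^ 0 + C (((1 + θ) ^ 3 - 4 * θ ^ 3) / 6) * X ^ 1 +
        C (((2 + θ) ^ 3 - 4 * (1 + θ) ^ 3 + 6 * θ ^ 3) / 6) * X ^ 2 +
        C ((1 - θ) ^ 3 / 6) * X ^ 3 := by
  set P := PowerSeries.mk (fun m : ℕ => ((m : ℝ) + θ) ^ 3 / 6) with hP
  have e : (1 - X) ^ 4 * P = P - C 4 * (X ^ 1 * P) + C 6 * (X ^ 2 * P) - C 4 * (X ^ 3 * P) +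
      X ^ 4 * P := by
    simp only [map_ofNat]
    ring
  rw [e]
  ext n
  simp only [map_add, map_sub, coeff_C_mul, coeff_X_pow_mul', coeff_X_pow, hP, coeff_mk]
  rcases n with _ | _ | _ | _ | n
  · norm_num
  · norm_num; ring
  · norm_num; ring
  · norm_num; ring
  -- From index 4 on, this is the full fourth difference of a cubic, which vanishes.
  · rw [if_pos (by omega), if_pos (by omega), if_pos (by omega), if_pos (by omega),
      if_neg (by omega), if_neg (by omega), if_neg (by omega), if_neg (by omega),
      show n + 1 + 1 + 1 + 1 - 1 = n + 3 by omega, show n + 1 + 1 + 1 + 1 - 2 = n + 2 by omega,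
      show n + 1 + 1 + 1 + 1 - 3 = n + 1 by omega, show n + 1 + 1 + 1 + 1 - 4 = n by omega]
    push_cast
    ring

/-- Four factors are what the cubes need; the exponent `4 - α` left over lies in `(2, 3)`, within
reach of the asymptotics. -/
theorem mk_binCoeff_neg_eq (α : ℝ) :
    PowerSeries.mk (binCoeff (-α)) = (1 - X) ^ 4 * PowerSeries.mk (binCoeff (4 - α)) := by
  have e0 := one_sub_X_mul_mk_binCoeff (-α)
  have e1 := one_sub_X_mul_mk_binCoeff (-α + 1)
  have e2 := one_sub_X_mul_mk_binCoeff (-α + 1 + 1)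
  have e3 := one_sub_X_mul_mk_binCoeff (-α + 1 + 1 + 1)
  rw [← e0, ← e1, ← e2, ← e3, show -α + 1 + 1 + 1 + 1 = 4 - α by ring]
  ring

/-- The B-spline values are nonnegative weights of mass 1 and mean `2 - θ`. Averaging the previous
estimate over them adds this mean to `1 - α/2`. -/
theorem exists_abs_sum_kappa_mul_cube_sub_le (h1 : 1 < α) (h2 : α < 2) :
    ∃ C : ℝ, 0 < C ∧ ∀ θ : ℝ, 0 ≤ θ → θ ≤ 1 → ∀ n : ℕ,
      |∑ l ∈ range (n + 1), kappa α l * (((n : ℝ) - l + θ) ^ 3 / 6) -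
        (binCoeff (4 - α) n - (3 - θ - α / 2) * binCoeff (3 - α) n)| ≤
        C * ((n : ℝ) + 1) ^ (1 - α) := by
  obtain ⟨C, hC, hb⟩ := exists_abs_coeff_smooth_mul_sub_le h1 h2
  refine ⟨C, hC, fun θ hθ0 hθ1 n => ?_⟩
  set F := PowerSeries.mk (smoothCoeff α) * PowerSeries.mk (binCoeff (4 - α)) with hF
  have hsum : ∑ l ∈ range (n + 1), kappa α l * (((n : ℝ) - l + θ) ^ 3 / 6) =
      coeff n (PowerSeries.mk (kappa α) *
        PowerSeries.mk (fun m : ℕ => ((m : ℝ) + θ) ^ 3 / 6)) := by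
    rw [coeff_mul, Nat.sum_antidiagonal_eq_sum_range_succ_mk]
    refine sum_congr rfl fun l hl => ?_
    have : l ≤ n := by have := mem_range.1 hl; omega
    rw [coeff_mk, coeff_mk, Nat.cast_sub this]
  have hprod : PowerSeries.mk (kappa α) * PowerSeries.mk (fun m : ℕ => ((m : ℝ) + θ) ^ 3 / 6) =
      PowerSeries.C (θ ^ 3 / 6) * (X ^ 0 * F) + PowerSeries.C (((1 + θ) ^ 3 - 4 * θ ^ 3) / 6) * (X ^ 1 * F) +
        PowerSeries.C (((2 + θ) ^ 3 - 4 * (1 + θ) ^ 3 + 6 * θ ^ 3) / 6) * (X ^ 2 * F) +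
        PowerSeries.C ((1 - θ) ^ 3 / 6) * (X ^ 3 * F) := by
    rw [mk_kappa h1, mk_binCoeff_neg_eq]
    linear_combination F * one_sub_X_pow_mul_mk_cube θ
  rw [hsum, hprod]
  simp only [map_add, coeff_C_mul]
  have b0 := hb 0 (by norm_num) n
  have b1 := hb 1 (by norm_num) n
  have b2 := hb 2 (by norm_num) n
  have b3 := hb 3 (by norm_num) n
  set D := C * ((n : ℝ) + 1) ^ (1 - α)
  set E0 := coeff n (X ^ 0 * F)
  set E1 := coeff n (X ^ 1 * F)
  set E2 := coeff n (X ^ 2 * F)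
  set E3 := coeff n (X ^ 3 * F)
  set c4 := binCoeff (4 - α) n
  set c3 := binCoeff (3 - α) n
  have g0 : 0 ≤ θ ^ 3 / 6 := by positivity
  have g1 : 0 ≤ ((1 + θ) ^ 3 - 4 * θ ^ 3) / 6 := by
    have : θ ^ 3 ≤ 1 := pow_le_one₀ hθ0 hθ1
    have : θ ^ 3 ≤ θ := by nlinarith [mul_nonneg hθ0 (by nlinarith : 0 ≤ 1 - θ ^ 2)]
    nlinarith
  have g2 : 0 ≤ ((2 + θ) ^ 3 - 4 * (1 + θ) ^ 3 + 6 * θ ^ 3) / 6 := by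
    have : (2 + θ) ^ 3 - 4 * (1 + θ) ^ 3 + 6 * θ ^ 3 = 4 - 6 * θ ^ 2 + 3 * θ ^ 3 := by ring
    rw [this]
    nlinarith [mul_nonneg hθ0 (by nlinarith : 0 ≤ 1 - θ ^ 2), sq_nonneg (1 - θ)]
  have g3 : 0 ≤ (1 - θ) ^ 3 / 6 := by
    have : 0 ≤ 1 - θ := by linarith
    positivity
  have key : θ ^ 3 / 6 * E0 + ((1 + θ) ^ 3 - 4 * θ ^ 3) / 6 * E1 +
      ((2 + θ) ^ 3 - 4 * (1 + θ) ^ 3 + 6 * θ ^ 3) / 6 * E2 + (1 - θ) ^ 3 / 6 * E3 -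
      (c4 - (3 - θ - α / 2) * c3) =
      θ ^ 3 / 6 * (E0 - c4 + ((0 : ℕ) + (1 - α / 2)) * c3) +
      ((1 + θ) ^ 3 - 4 * θ ^ 3) / 6 * (E1 - c4 + ((1 : ℕ) + (1 - α / 2)) * c3) +
      ((2 + θ) ^ 3 - 4 * (1 + θ) ^ 3 + 6 * θ ^ 3) / 6 *
        (E2 - c4 + ((2 : ℕ) + (1 - α / 2)) * c3) +
      (1 - θ) ^ 3 / 6 * (E3 - c4 + ((3 : ℕ) + (1 - α / 2)) * c3) := by
    push_cast; ring
  rw [key]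
  have one : D = θ ^ 3 / 6 * D + ((1 + θ) ^ 3 - 4 * θ ^ 3) / 6 * D +
      ((2 + θ) ^ 3 - 4 * (1 + θ) ^ 3 + 6 * θ ^ 3) / 6 * D + (1 - θ) ^ 3 / 6 * D := by ring
  rw [one]
  refine (abs_add_le _ _).trans (add_le_add ((abs_add_le _ _).trans (add_le_add
    ((abs_add_le _ _).trans (add_le_add ?_ ?_)) ?_)) ?_)
  · rw [abs_mul, abs_of_nonneg g0]; gcongr
  · rw [abs_mul, abs_of_nonneg g1]; gcongr
  · rw [abs_mul, abs_of_nonneg g2]; gcongr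
  · rw [abs_mul, abs_of_nonneg g3]; gcongr

end

/-- Second-order remainder of truncated powers. -/
theorem abs_max_rpow_sub_taylor_le {p X s : ℝ} (hp1 : 1 ≤ p) (hp2 : p ≤ 2) (hX : 0 < X)
    (hs : 0 ≤ s) :
    |max (X - s) 0 ^ p - (X ^ p - p * s * X ^ (p - 1))| ≤ 2 * s ^ 2 * X ^ (p - 2) := by
  set y := s / X with hy
  have hy0 : 0 ≤ y := by positivity
  have hsy : s = y * X := by rw [hy]; field_simp
  have hmax : max (X - s) 0 = max (1 - y) 0 * X := by
    rw [max_mul_of_nonneg _ _ hX.le, hsy]; ring_nf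
  have e1 : X ^ (p - 1) * X = X ^ p := by
    rw [← Real.rpow_add_one hX.ne']; ring_nf
  have e2 : X ^ (p - 2) * X ^ 2 = X ^ p := by
    rw [← Real.rpow_natCast, ← Real.rpow_add hX]; norm_num
  have hpX : 0 < X ^ p := by positivity
  -- After scaling to `X = 1`, Bernoulli's inequality bounds the power from below, and from above
  -- after splitting off one factor `1 - y`. For `y > 1` the truncated power is zero.
  have key : |max (1 - y) 0 ^ p - (1 - p * y)| ≤ 2 * y ^ 2 := by
    rcases le_or_gt y 1 with h | h
    · rw [max_eq_left (by linarith)]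
      have l1 := one_add_mul_self_le_rpow_one_add (s := -y) (by linarith) hp1
      have l2 : (1 - y) ^ p ≤ 1 - p * y + (p - 1) * y ^ 2 := by
        rcases eq_or_lt_of_le h with h' | h'
        · rw [h', sub_self, Real.zero_rpow (by linarith)]; linarith
        · have l3 := rpow_one_add_le_one_add_mul_self (s := -y) (p := p - 1) (by linarith)
            (by linarith) (by linarith)
          have l4 : (1 - y) ^ p = (1 + -y) ^ (p - 1) * (1 - y) := by
            rw [← sub_eq_add_neg, ← Real.rpow_add_one (by linarith)]; ring_nf
          rw [l4]
          have := mul_le_mul_of_nonneg_right l3 (by linarith : 0 ≤ 1 - y)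
          linarith
      rw [← sub_eq_add_neg] at l1
      rw [abs_le]
      constructor <;> nlinarith [sq_nonneg y]
    · rw [max_eq_right (by linarith), Real.zero_rpow (by linarith), abs_le]
      constructor <;> nlinarith
  have : max (X - s) 0 ^ p - (X ^ p - p * s * X ^ (p - 1)) =
      (max (1 - y) 0 ^ p - (1 - p * y)) * X ^ p := by
    rw [hmax, Real.mul_rpow (le_max_right _ _) hX.le, hsy]
    linear_combination p * y * e1
  rw [this, abs_mul, abs_of_pos hpX, hsy]
  calc _ ≤ 2 * y ^ 2 * X ^ p := by gcongr
    _ = _ := by rw [← e2]; ring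

theorem rpow_add_half_sub_le {Y q : ℝ} (hq0 : 0 ≤ q) (hq1 : q ≤ 1) (hY : 0 < Y) :
    |(Y + 1 / 2) ^ q - Y ^ q| ≤ Y ^ (q - 1) := by
  have h1 : Y ^ q ≤ (Y + 1 / 2) ^ q := Real.rpow_le_rpow hY.le (by linarith) hq0
  have h2 := rpow_one_add_le_one_add_mul_self (s := 1 / (2 * Y)) (p := q)
    (by have : 0 < 1 / (2 * Y) := by positivity
        linarith) hq0 hq1
  have h3 : Y + 1 / 2 = Y * (1 + 1 / (2 * Y)) := by field_simp
  have h4 : Y ^ q = Y ^ (q - 1) * Y := by rw [← Real.rpow_add_one hY.ne']; ring_nf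
  rw [abs_of_nonneg (by linarith), h3, Real.mul_rpow hY.le (by positivity)]
  have h5 : 0 < Y ^ q := by positivity
  have h6 : Y ^ q * (1 + 1 / (2 * Y)) ^ q ≤ Y ^ q * (1 + q * (1 / (2 * Y))) := by gcongr
  have h7 : Y ^ q * (q * (1 / (2 * Y))) = Y ^ (q - 1) * (q / 2) := by rw [h4]; field_simp
  have h8 : 0 < Y ^ (q - 1) := by positivity
  nlinarith

section

variable {α : ℝ}

/-- With `X = n + (4 - α)/2` and `s = 3 - θ - α/2` one has `X - s = n - 1 + θ`. Since `Γ(4 - α) = (3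
- α) Γ(3 - α)`, the two coefficients give the first two Taylor terms of `(X - s)^(3 - α)`, up to the
half-step between the centres `X` and `Y`. -/
theorem exists_abs_Gamma_mul_sub_rpow_le (h1 : 1 < α) (h2 : α < 2) :
    ∃ C : ℝ, 0 < C ∧ ∀ θ : ℝ, 0 ≤ θ → θ ≤ 1 → ∀ n : ℕ,
      |Real.Gamma (4 - α) * (binCoeff (4 - α) n - (3 - θ - α / 2) * binCoeff (3 - α) n) -
        max ((n : ℝ) - 1 + θ) 0 ^ (3 - α)| ≤ C * ((n : ℝ) + 1) ^ (1 - α) := by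
  obtain ⟨C1, hC1, ha1⟩ := exists_abs_Gamma_mul_binCoeff_sub_le (γ := 4 - α) (by linarith)
    (by linarith)
  obtain ⟨C2, hC2, ha2⟩ := exists_abs_Gamma_mul_binCoeff_sub_le (γ := 3 - α) (by linarith)
    (by linarith)
  have hΓ' : Real.Gamma (4 - α) = (3 - α) * Real.Gamma (3 - α) := by
    rw [← Real.Gamma_add_one (by linarith)]; ring_nf
  refine ⟨C1 + 6 * (C2 + 2) + 18, by positivity, fun θ hθ0 hθ1 n => ?_⟩
  have hn : (0 : ℝ) ≤ n := n.cast_nonneg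
  have b1 := ha1 n
  have b2 := ha2 n
  obtain ⟨W, hW⟩ : ∃ W, W = ((n : ℝ) + 1) ^ (1 - α) := ⟨_, rfl⟩
  have hW0 : 0 < W := by rw [hW]; positivity
  obtain ⟨s, hs⟩ : ∃ s, s = 3 - θ - α / 2 := ⟨_, rfl⟩
  obtain ⟨X, hX⟩ : ∃ X, X = (n : ℝ) + (4 - α) / 2 := ⟨_, rfl⟩
  obtain ⟨Y, hY⟩ : ∃ Y, Y = (n : ℝ) + (3 - α) / 2 := ⟨_, rfl⟩
  have hX1 : (n : ℝ) + 1 ≤ X := by rw [hX]; linarith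
  have hX0 : 0 < X := by linarith
  have hY1 : ((n : ℝ) + 1) / 2 ≤ Y := by rw [hY]; linarith
  have hY0 : 0 < Y := by linarith
  have hs0 : 0 ≤ s := by rw [hs]; linarith
  have hs3 : s ≤ 3 := by rw [hs]; linarith
  have hXs : (n : ℝ) - 1 + θ = X - s := by rw [hX, hs]; ring
  rw [show 4 - α - 1 = 3 - α by ring, show 4 - α - 3 = 1 - α by ring, ← hW, ← hX] at b1
  rw [show 3 - α - 1 = 2 - α by ring, show 3 - α - 3 = -α by ring, ← hY] at b2
  have b2' : ((n : ℝ) + 1) ^ (-α) ≤ W := by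
    rw [hW]
    exact Real.rpow_le_rpow_of_exponent_le (by linarith) (by linarith)
  have b3 := abs_max_rpow_sub_taylor_le (p := 3 - α) (by linarith) (by linarith) hX0 hs0
  rw [show 3 - α - 1 = 2 - α by ring, show 3 - α - 2 = 1 - α by ring] at b3
  have b3' : X ^ (1 - α) ≤ W := by
    rw [hW]
    exact Real.rpow_le_rpow_of_nonpos (by linarith) hX1 (by linarith)
  have b4 := rpow_add_half_sub_le (q := 2 - α) (by linarith) (by linarith) hY0
  rw [show 2 - α - 1 = 1 - α by ring, show Y + 1 / 2 = X by rw [hX, hY]; ring] at b4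
  have b4' : Y ^ (1 - α) ≤ 2 * W := by
    have t1 : Y ^ (1 - α) ≤ (((n : ℝ) + 1) / 2) ^ (1 - α) :=
      Real.rpow_le_rpow_of_nonpos (by linarith) hY1 (by linarith)
    rw [Real.div_rpow (by linarith) (by norm_num), ← hW] at t1
    have t2 : (2 : ℝ) ^ (-1 : ℝ) ≤ 2 ^ (1 - α) :=
      Real.rpow_le_rpow_of_exponent_le (by norm_num) (by linarith)
    rw [Real.rpow_neg_one] at t2
    refine t1.trans ?_
    rw [div_le_iff₀ (by positivity)]
    nlinarith
  rw [hXs, ← hs, ← hW]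
  generalize binCoeff (4 - α) n = c4 at b1 ⊢
  generalize binCoeff (3 - α) n = c3 at b2 ⊢
  have e : Real.Gamma (4 - α) * (c4 - s * c3) - max (X - s) 0 ^ (3 - α) =
      (Real.Gamma (4 - α) * c4 - X ^ (3 - α)) -
      (3 - α) * s * ((Real.Gamma (3 - α) * c3 - Y ^ (2 - α)) - (X ^ (2 - α) - Y ^ (2 - α))) -
      (max (X - s) 0 ^ (3 - α) - (X ^ (3 - α) - (3 - α) * s * X ^ (2 - α))) := by
    rw [hΓ']; ring
  have f1 : |(3 - α) * s * ((Real.Gamma (3 - α) * c3 - Y ^ (2 - α)) -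
      (X ^ (2 - α) - Y ^ (2 - α)))| ≤ 6 * ((C2 + 2) * W) := by
    have hps : 0 ≤ (3 - α) * s := mul_nonneg (by linarith) hs0
    rw [abs_mul, abs_of_nonneg hps]
    refine mul_le_mul (by nlinarith) ?_ (abs_nonneg _) (by norm_num)
    refine (abs_sub _ _).trans ?_
    have : C2 * ((n : ℝ) + 1) ^ (-α) ≤ C2 * W := by gcongr
    linarith
  have f2 : 2 * s ^ 2 * X ^ (1 - α) ≤ 18 * W := by
    have : 2 * s ^ 2 ≤ 18 := by nlinarith
    exact mul_le_mul this b3' (by positivity) (by norm_num)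
  rw [e]
  refine (abs_sub _ _).trans ((add_le_add ((abs_sub _ _).trans (add_le_add b1 f1))
    (b3.trans f2)).trans (le_of_eq ?_))
  ring

theorem exists_abs_sum_kappa_mul_cube_sub_rpow_le (h1 : 1 < α) (h2 : α < 2) :
    ∃ C : ℝ, 0 < C ∧ ∀ θ : ℝ, 0 ≤ θ → θ ≤ 1 → ∀ n : ℕ,
      |∑ l ∈ range (n + 1), kappa α l * (((n : ℝ) - l + θ) ^ 3 / 6) -
        max ((n : ℝ) - 1 + θ) 0 ^ (3 - α) / Real.Gamma (4 - α)| ≤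
        C * ((n : ℝ) + 1) ^ (1 - α) := by
  obtain ⟨C0, hC0, hb⟩ := exists_abs_sum_kappa_mul_cube_sub_le h1 h2
  obtain ⟨C1, hC1, hg⟩ := exists_abs_Gamma_mul_sub_rpow_le h1 h2
  have hΓ : 0 < Real.Gamma (4 - α) := Real.Gamma_pos_of_pos (by linarith)
  refine ⟨C0 + C1 / Real.Gamma (4 - α), by positivity, fun θ hθ0 hθ1 n => ?_⟩
  have b0 := hb θ hθ0 hθ1 n
  have b1 := hg θ hθ0 hθ1 n
  generalize binCoeff (4 - α) n - (3 - θ - α / 2) * binCoeff (3 - α) n = c at b0 b1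
  generalize ∑ l ∈ range (n + 1), kappa α l * (((n : ℝ) - l + θ) ^ 3 / 6) = S at b0 ⊢
  generalize max ((n : ℝ) - 1 + θ) 0 ^ (3 - α) = P at b1 ⊢
  have split : S - P / Real.Gamma (4 - α) = (S - c) +
      (Real.Gamma (4 - α) * c - P) / Real.Gamma (4 - α) := by
    rw [sub_div, mul_div_cancel_left₀ _ hΓ.ne']; ring
  rw [split, add_mul]
  refine (abs_add_le _ _).trans (add_le_add b0 ?_)
  rw [abs_div, abs_of_pos hΓ, div_mul_eq_mul_div]
  gcongr

/-- The Peano kernel of the shifted difference operator with unit step. -/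
theorem exists_abs_peanoKernel_le (h1 : 1 < α) (h2 : α < 2) :
    ∃ C : ℝ, 0 < C ∧ ∀ y : ℝ, -1 ≤ y → ∀ L : ℕ, y + 1 < L →
      |∑ l ∈ range L, kappa α l * (max (y + 1 - l) 0 ^ 3 / 6) -
        max y 0 ^ (3 - α) / Real.Gamma (4 - α)| ≤ C * (y + 2) ^ (1 - α) := by
  obtain ⟨C, hC, hb⟩ := exists_abs_sum_kappa_mul_cube_sub_rpow_le h1 h2
  refine ⟨C * 2, by positivity, fun y hy L hL => ?_⟩
  -- The fractional part of `y + 1` plays the role of `θ`; terms with `l > n` vanish.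
  set n := ⌊y + 1⌋₊ with hn
  have f1 : (n : ℝ) ≤ y + 1 := Nat.floor_le (by linarith)
  have f2 : y + 1 < n + 1 := Nat.lt_floor_add_one _
  have hnL : n < L := (Nat.floor_lt (by linarith)).2 hL
  have h := hb (y + 1 - n) (by linarith) (by linarith) n
  have hsum : ∑ l ∈ range L, kappa α l * (max (y + 1 - l) 0 ^ 3 / 6) =
      ∑ l ∈ range (n + 1), kappa α l * (((n : ℝ) - l + (y + 1 - n)) ^ 3 / 6) := by
    rw [← sum_subset (range_mono (by omega : n + 1 ≤ L))]
    · refine sum_congr rfl fun l hl => ?_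
      have : (l : ℝ) ≤ n := by exact_mod_cast (by have := mem_range.1 hl; omega)
      rw [max_eq_left (by linarith)]
      ring_nf
    · intro l _ hl
      have : n + 1 ≤ l := by simpa using hl
      have : (n : ℝ) + 1 ≤ l := by exact_mod_cast this
      rw [max_eq_right (by linarith)]
      simp
  rw [hsum]
  rw [show (n : ℝ) - 1 + (y + 1 - n) = y by ring] at h
  refine h.trans ?_
  rw [mul_assoc]
  refine mul_le_mul_of_nonneg_left ?_ hC.le
  have hn0 : (0 : ℝ) ≤ n := n.cast_nonneg
  have t1 : ((n : ℝ) + 1) ^ (1 - α) ≤ ((y + 2) / 2) ^ (1 - α) :=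
    Real.rpow_le_rpow_of_nonpos (by linarith) (by linarith) (by linarith)
  rw [Real.div_rpow (by linarith) (by norm_num)] at t1
  have t2 : (2 : ℝ) ^ (-1 : ℝ) ≤ 2 ^ (1 - α) :=
    Real.rpow_le_rpow_of_exponent_le (by norm_num) (by linarith)
  rw [Real.rpow_neg_one] at t2
  refine t1.trans ?_
  rw [div_le_iff₀ (by positivity)]
  have : 0 < (y + 2) ^ (1 - α) := Real.rpow_pos_of_pos (by linarith) _
  nlinarith

end

end RieszScheme

end

/-! ### Fourth-derivative representations and one-sided consistency -/

section

open Filter Topology Finset MeasureTheory Set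

namespace RieszScheme

/-! Integral representations. -/

theorem intervalIntegrable_sub_rpow {q : ℝ} (hq : -1 < q) (y a b : ℝ) :
    IntervalIntegrable (fun s : ℝ => (y - s) ^ q) volume a b := by
  have := (intervalIntegral.intervalIntegrable_rpow' (a := y - a) (b := y - b) hq).comp_sub_left y
  simpa using this

theorem integral_sub_rpow {q : ℝ} (hq : -1 < q) (y r : ℝ) :
    ∫ s in r..y, (y - s) ^ q = (y - r) ^ (q + 1) / (q + 1) := by
  rw [intervalIntegral.integral_comp_sub_left (fun s => s ^ q) y, sub_self,
    integral_rpow (Or.inl hq), Real.zero_rpow (by linarith), sub_zero]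

/-- Integration by parts for fractional integrals. -/
theorem integral_primitive_mul_sub_rpow {g : ℝ → ℝ} {a y q : ℝ} (hay : a ≤ y) (hq : -1 < q)
    (hg : IntervalIntegrable g volume a y) :
    ∫ s in a..y, (∫ r in a..s, g r) * (y - s) ^ q =
      (∫ r in a..y, g r * (y - r) ^ (q + 1)) / (q + 1) := by
  have hk := intervalIntegrable_sub_rpow hq y a y
  -- The triangle `r ≤ s` is encoded by an indicator, so that Fubini applies on a square.
  have h1 : ∫ s in a..y, (∫ r in a..s, g r) * (y - s) ^ q =
      ∫ s in a..y, ∫ r in a..y, (y - s) ^ q * indicator {r | r ≤ s} g r := by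
    refine intervalIntegral.integral_congr fun s hs => ?_
    rw [uIcc_of_le hay] at hs
    rw [intervalIntegral.integral_const_mul, intervalIntegral.integral_indicator hs, mul_comm]
  have hint : IntegrableOn (Function.uncurry fun s r => (y - s) ^ q * indicator {r | r ≤ s} g r)
      (uIoc a y ×ˢ uIoc a y) := by
    have h2 : Integrable (fun p : ℝ × ℝ => (y - p.1) ^ q * g p.2)
        ((volume.restrict (uIoc a y)).prod (volume.restrict (uIoc a y))) :=
      Integrable.mul_prod (f := fun s => (y - s) ^ q) (intervalIntegrable_iff.1 hk)
        (intervalIntegrable_iff.1 hg)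
    rw [Measure.prod_restrict, ← Measure.volume_eq_prod] at h2
    have h3 : MeasurableSet {p : ℝ × ℝ | p.2 ≤ p.1} :=
      measurableSet_le measurable_snd measurable_fst
    refine (h2.indicator h3).congr (ae_of_all _ fun p => ?_)
    by_cases hp : p.2 ≤ p.1 <;> simp [Function.uncurry, indicator, hp]
  rw [h1, intervalIntegral_intervalIntegral_swap hint, ← intervalIntegral.integral_div]
  refine intervalIntegral.integral_congr fun r hr => ?_
  rw [uIcc_of_le hay] at hr
  have i1 : IntervalIntegrable (fun s => (y - s) ^ q * indicator {r | r ≤ s} g r) volume a y := by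
    have h3 : MeasurableSet {s : ℝ | r ≤ s} := measurableSet_Ici
    have := (intervalIntegrable_iff.1 (hk.mul_const (g r))).indicator h3
    rw [intervalIntegrable_iff]
    refine this.congr (ae_of_all _ fun s => ?_)
    by_cases hp : r ≤ s <;> simp [indicator, hp]
  have hr' : uIcc a r ⊆ uIcc a y := by
    rw [uIcc_of_le hr.1, uIcc_of_le hay]; exact Icc_subset_Icc_right hr.2
  have hr'' : uIcc r y ⊆ uIcc a y := by
    rw [uIcc_of_le hr.2, uIcc_of_le hay]; exact Icc_subset_Icc_left hr.1
  rw [← intervalIntegral.integral_add_adjacent_intervals (i1.mono_set hr') (i1.mono_set hr'')]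
  have e1 : ∫ s in a..r, (y - s) ^ q * indicator {r | r ≤ s} g r = 0 := by
    refine intervalIntegral.integral_zero_ae ?_
    have hne : ∀ᵐ s : ℝ, s ≠ r := by simp [ae_iff, measure_singleton]
    filter_upwards [hne] with s hs hs'
    rw [uIoc_of_le hr.1] at hs'
    have : ¬ r ≤ s := not_le.2 (lt_of_le_of_ne hs'.2 hs)
    simp [indicator, this]
  have e2 : ∫ s in r..y, (y - s) ^ q * indicator {r | r ≤ s} g r =
      ∫ s in r..y, (y - s) ^ q * g r := by
    refine intervalIntegral.integral_congr fun s hs => ?_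
    rw [uIcc_of_le hr.2] at hs
    simp [indicator, hs.1]
  rw [e1, e2, zero_add, intervalIntegral.integral_mul_const, integral_sub_rpow hq]
  ring

theorem hasDerivAt_max_rpow {p : ℝ} (hp : 1 < p) (t : ℝ) :
    HasDerivAt (fun t : ℝ => max t 0 ^ p) (p * max t 0 ^ (p - 1)) t := by
  rcases lt_trichotomy t 0 with h | rfl | h
  · rw [max_eq_right h.le, Real.zero_rpow (by linarith), mul_zero]
    refine (hasDerivAt_const t (0 : ℝ)).congr_of_eventuallyEq ?_
    filter_upwards [Iio_mem_nhds h] with s hs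
    rw [max_eq_right (le_of_lt hs), Real.zero_rpow (by linarith)]
  · rw [max_self, Real.zero_rpow (by linarith), mul_zero, hasDerivAt_iff_tendsto_slope]
    have h1 : Tendsto (fun t : ℝ => max t 0 ^ (p - 1)) (𝓝[≠] 0) (𝓝 0) := by
      have : ContinuousAt (fun t : ℝ => max t 0 ^ (p - 1)) 0 :=
        ContinuousAt.rpow_const (by fun_prop) (Or.inr (by linarith))
      have h2 := this.tendsto.mono_left (nhdsWithin_le_nhds (s := {0}ᶜ))
      simpa [Real.zero_rpow (by linarith : p - 1 ≠ 0)] using h2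
    refine h1.congr' ?_
    filter_upwards [self_mem_nhdsWithin] with s hs
    have hs' : s ≠ 0 := hs
    rw [slope_def_field, max_self, Real.zero_rpow (by linarith), sub_zero, sub_zero]
    rcases lt_or_gt_of_ne hs' with h | h
    · rw [max_eq_right h.le, Real.zero_rpow (by linarith), Real.zero_rpow (by linarith), zero_div]
    · rw [max_eq_left h.le, Real.rpow_sub_one hs']
  · rw [max_eq_left h.le]
    refine (Real.hasDerivAt_rpow_const (Or.inl h.ne')).congr_of_eventuallyEq ?_
    filter_upwards [Ioi_mem_nhds h] with s hs
    rw [max_eq_left (le_of_lt hs)]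

theorem continuous_max_sub_rpow {p : ℝ} (hp : 0 ≤ p) (y : ℝ) :
    Continuous fun s : ℝ => max (y - s) 0 ^ p :=
  Continuous.rpow_const (by fun_prop) fun _ => Or.inr hp

/-- Differentiation of fractional integrals with a fixed domain of integration. -/
theorem hasDerivAt_integral_mul_max_rpow {w : ℝ → ℝ} {a c p : ℝ} (hp : 1 < p)
    (hw : IntervalIntegrable w volume a c) (x : ℝ) :
    HasDerivAt (fun y => ∫ s in a..c, w s * max (y - s) 0 ^ p)
      (p * ∫ s in a..c, w s * max (x - s) 0 ^ (p - 1)) x := by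
  have hint : ∀ q : ℝ, 0 ≤ q → ∀ y, IntervalIntegrable (fun s => w s * max (y - s) 0 ^ q)
      volume a c := fun q hq y => hw.mul_continuousOn (continuous_max_sub_rpow hq y).continuousOn
  rw [← intervalIntegral.integral_const_mul]
  have key := intervalIntegral.hasDerivAt_integral_of_dominated_loc_of_deriv_le
    (μ := volume) (a := a) (b := c)
    (F := fun y s => w s * max (y - s) 0 ^ p)
    (F' := fun y s => p * (w s * max (y - s) 0 ^ (p - 1))) (x₀ := x)
    (bound := fun s => p * (|w s| * max (x + 1 - s) 0 ^ (p - 1)))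
    (Metric.ball_mem_nhds x one_pos)
    (Eventually.of_forall fun y => (intervalIntegrable_iff.1 (hint p (by linarith) y)).1)
    (hint p (by linarith) x)
    (intervalIntegrable_iff.1 ((hint (p - 1) (by linarith) x).const_mul p)).1
    (ae_of_all _ fun s _ y hy => ?_)
    ((hw.abs.mul_continuousOn
      (continuous_max_sub_rpow (by linarith : 0 ≤ p - 1) (x + 1)).continuousOn).const_mul p)
    (ae_of_all _ fun s _ y _ => ?_)
  · exact key.2
  · rw [Metric.mem_ball, Real.dist_eq, abs_lt] at hy
    have h1 : max (y - s) 0 ^ (p - 1) ≤ max (x + 1 - s) 0 ^ (p - 1) :=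
      Real.rpow_le_rpow (le_max_right _ _) (max_le_max (by linarith) le_rfl) (by linarith)
    have h0 : 0 ≤ max (y - s) 0 ^ (p - 1) := Real.rpow_nonneg (le_max_right _ _) _
    rw [norm_mul, norm_mul, Real.norm_of_nonneg (by linarith : 0 ≤ p), Real.norm_of_nonneg h0,
      Real.norm_eq_abs]
    gcongr
  · have h1 : HasDerivAt (fun y : ℝ => y - s) 1 y := (hasDerivAt_id y).sub_const s
    have h2 := ((hasDerivAt_max_rpow hp (y - s)).comp y h1).const_mul (w s)
    refine h2.congr_deriv ?_
    ring

/-- Truncating the kernel removes `y` from the limits of integration, so that one can differentiate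
under the integral. -/
theorem integral_mul_sub_rpow_eq {w : ℝ → ℝ} {a y c p : ℝ} (hp : 0 < p) (hay : a ≤ y)
    (hyc : y ≤ c) :
    ∫ s in a..y, w s * (y - s) ^ p = ∫ s in a..c, w s * max (y - s) 0 ^ p := by
  have h1 : ∫ s in a..y, w s * (y - s) ^ p =
      ∫ s in a..c, indicator {s | s ≤ y} (fun s => w s * (y - s) ^ p) s :=
    (intervalIntegral.integral_indicator ⟨hay, hyc⟩).symm
  rw [h1]
  refine intervalIntegral.integral_congr fun s _ => ?_
  by_cases hs : s ≤ y
  · simp [indicator, hs]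
  · simp [indicator, hs, max_eq_right (sub_nonpos.2 (not_le.1 hs).le), Real.zero_rpow hp.ne']

/-- `v` vanishes to the left of `a`, is `C³`, and its third derivative is a primitive of the
measurable function `w`, which is bounded by `V`. -/
structure HasFourthDeriv (a V : ℝ) (v w : ℝ → ℝ) : Prop where
  contDiff : ContDiff ℝ 3 v
  eq_zero : ∀ x < a, v x = 0
  measurable : Measurable w
  bound : ∀ x, |w x| ≤ V
  integral_eq : ∀ x y, iteratedDeriv 3 v y - iteratedDeriv 3 v x = ∫ s in x..y, w s

namespace HasFourthDeriv

variable {a V : ℝ} {v w : ℝ → ℝ}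

theorem intervalIntegrable (hv : HasFourthDeriv a V v w) (x y : ℝ) :
    IntervalIntegrable w volume x y := by
  rw [intervalIntegrable_iff]
  exact Measure.integrableOn_of_bounded (M := V) (by simp)
    hv.measurable.aestronglyMeasurable (ae_of_all _ fun s => hv.bound s)

/-- Continuity from the left of `a`. Integration by parts therefore leaves no boundary terms at `a`.
-/
theorem iteratedDeriv_eq_zero (hv : HasFourthDeriv a V v w) {k : ℕ} (hk : k ≤ 3) :
    iteratedDeriv k v a = 0 := by
  have hcont : Continuous (iteratedDeriv k v) :=
    hv.contDiff.continuous_iteratedDeriv k (by exact_mod_cast hk)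
  have hz : ∀ x < a, iteratedDeriv k v x = 0 := by
    intro x hx
    have : v =ᶠ[𝓝 x] fun _ => 0 := by
      filter_upwards [Iio_mem_nhds hx] with y hy using hv.eq_zero y hy
    rw [this.iteratedDeriv_eq]
    simp
  have h1 : Tendsto (iteratedDeriv k v) (𝓝[<] a) (𝓝 (iteratedDeriv k v a)) :=
    hcont.continuousAt.tendsto.mono_left nhdsWithin_le_nhds
  refine tendsto_nhds_unique h1 (tendsto_const_nhds.congr' ?_)
  filter_upwards [self_mem_nhdsWithin] with x hx using (hz x hx).symm

theorem hasDerivAt_iteratedDeriv (hv : HasFourthDeriv a V v w) {k : ℕ} (hk : k < 3) (x : ℝ) :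
    HasDerivAt (iteratedDeriv k v) (iteratedDeriv (k + 1) v x) x := by
  rw [iteratedDeriv_succ]
  exact (hv.contDiff.differentiable_iteratedDeriv k (by exact_mod_cast hk) x).hasDerivAt

theorem iteratedDeriv_eq_integral (hv : HasFourthDeriv a V v w) {k : ℕ} (hk : k < 3) (y : ℝ) :
    iteratedDeriv k v y = ∫ s in a..y, iteratedDeriv (k + 1) v s := by
  rw [intervalIntegral.integral_eq_sub_of_hasDerivAt
    (fun x _ => hv.hasDerivAt_iteratedDeriv hk x)
    ((hv.contDiff.continuous_iteratedDeriv (k + 1) (by exact_mod_cast hk)).intervalIntegrable _ _),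
    hv.iteratedDeriv_eq_zero hk.le, sub_zero]

theorem iteratedDeriv_three_eq_integral (hv : HasFourthDeriv a V v w) (y : ℝ) :
    iteratedDeriv 3 v y = ∫ s in a..y, w s := by
  rw [← hv.integral_eq, hv.iteratedDeriv_eq_zero le_rfl, sub_zero]

theorem integral_iteratedDeriv_mul_sub_rpow (hv : HasFourthDeriv a V v w) {k : ℕ} (hk : k < 3)
    {p y : ℝ} (hp : -1 < p) (hay : a ≤ y) :
    ∫ s in a..y, iteratedDeriv k v s * (y - s) ^ p =
      (∫ s in a..y, iteratedDeriv (k + 1) v s * (y - s) ^ (p + 1)) / (p + 1) := by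
  rw [← integral_primitive_mul_sub_rpow hay hp
    ((hv.contDiff.continuous_iteratedDeriv (k + 1)
      (by exact_mod_cast hk)).intervalIntegrable _ _)]
  exact intervalIntegral.integral_congr fun s _ => by
    simp only [hv.iteratedDeriv_eq_integral hk s]

theorem integral_iteratedDeriv_three_mul_sub_rpow (hv : HasFourthDeriv a V v w)
    {p y : ℝ} (hp : -1 < p) (hay : a ≤ y) :
    ∫ s in a..y, iteratedDeriv 3 v s * (y - s) ^ p =
      (∫ s in a..y, w s * (y - s) ^ (p + 1)) / (p + 1) := by
  rw [← integral_primitive_mul_sub_rpow hay hp (hv.intervalIntegrable _ _)]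
  exact intervalIntegral.integral_congr fun s _ => by
    simp only [hv.iteratedDeriv_three_eq_integral s]

/-- Repeated integration by parts. -/
theorem integral_mul_sub_rpow (hv : HasFourthDeriv a V v w) {q y : ℝ} (hq : -1 < q)
    (hay : a ≤ y) :
    ∫ s in a..y, v s * (y - s) ^ q =
      (∫ s in a..y, w s * (y - s) ^ (q + 4)) / ((q + 1) * (q + 2) * (q + 3) * (q + 4)) := by
  have s0 := hv.integral_iteratedDeriv_mul_sub_rpow (k := 0) (by norm_num) hq hay
  simp only [iteratedDeriv_zero, zero_add] at s0
  rw [s0, hv.integral_iteratedDeriv_mul_sub_rpow (k := 1) (by norm_num) (by linarith) hay,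
    hv.integral_iteratedDeriv_mul_sub_rpow (k := 2) (by norm_num) (by linarith) hay,
    hv.integral_iteratedDeriv_three_mul_sub_rpow (by linarith) hay, div_div, div_div, div_div]
  ring_nf

/-- Taylor's formula with integral remainder. -/
theorem eq_integral (hv : HasFourthDeriv a V v w) {y : ℝ} (hay : a ≤ y) :
    v y = (∫ s in a..y, w s * (y - s) ^ (3 : ℝ)) / 6 := by
  have h0 := hv.iteratedDeriv_eq_integral (k := 0) (by norm_num) y
  simp only [iteratedDeriv_zero, zero_add] at h0
  -- The trivial factor with exponent 0 starts the fractional integration by parts.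
  have h1 : ∫ s in a..y, iteratedDeriv 1 v s =
      ∫ s in a..y, iteratedDeriv 1 v s * (y - s) ^ (0 : ℝ) := by simp
  rw [h0, h1, hv.integral_iteratedDeriv_mul_sub_rpow (k := 1) (by norm_num) (by norm_num) hay,
    hv.integral_iteratedDeriv_mul_sub_rpow (k := 2) (by norm_num) (by norm_num) hay,
    hv.integral_iteratedDeriv_three_mul_sub_rpow (by norm_num) hay, div_div, div_div]
  norm_num

theorem eq_integral_max (hv : HasFourthDeriv a V v w) {y c : ℝ} (hay : a ≤ y) (hyc : y ≤ c) :
    v y = ∫ s in a..c, w s * (max (y - s) 0 ^ 3 / 6) := by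
  rw [hv.eq_integral hay, integral_mul_sub_rpow_eq (by norm_num) hay hyc,
    ← intervalIntegral.integral_div]
  refine intervalIntegral.integral_congr fun s _ => ?_
  norm_cast
  rw [mul_div_assoc]

/-- The left Riemann–Liouville derivative as a fractional integral of the fourth derivative. -/
theorem leftRL_eq (hv : HasFourthDeriv a V v w) {α b x : ℝ} (h1 : 1 < α) (h2 : α < 2)
    (hx : x ∈ Ioo a b) {f : ℝ → ℝ} (hf : EqOn f v (Icc a b)) :
    leftRL a α f x =
      (∫ s in a..b, w s * max (x - s) 0 ^ (3 - α)) / Real.Gamma (4 - α) := by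
  have hne2 : 2 - α ≠ 0 := by linarith
  have hne3 : 3 - α ≠ 0 := by linarith
  have hne4 : 4 - α ≠ 0 := by linarith
  have hne5 : 5 - α ≠ 0 := by linarith
  have hΓ : Real.Gamma (4 - α) = (3 - α) * ((2 - α) * Real.Gamma (2 - α)) := by
    rw [← Real.Gamma_add_one hne2, show 2 - α + 1 = 3 - α by ring, ← Real.Gamma_add_one hne3]
    ring_nf
  have hΓ2 : Real.Gamma (2 - α) ≠ 0 := (Real.Gamma_pos_of_pos (by linarith)).ne'
  -- Four integrations by parts raise the exponent from `1 - α` to `5 - α`, smooth enough for the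
  -- two outer derivatives to pass under the integral, ending at `3 - α`.
  have hev : (fun y => ∫ s in a..y, f s / (y - s) ^ (α - 1)) =ᶠ[𝓝 x]
      fun y => ((2 - α) * (3 - α) * (4 - α) * (5 - α))⁻¹ *
        ∫ s in a..b, w s * max (y - s) 0 ^ (5 - α) := by
    filter_upwards [Ioo_mem_nhds hx.1 hx.2] with y hy
    have e1 : ∫ s in a..y, f s / (y - s) ^ (α - 1) = ∫ s in a..y, v s * (y - s) ^ (1 - α) := by
      refine intervalIntegral.integral_congr fun s hs => ?_
      rw [uIcc_of_le hy.1.le] at hs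
      rw [hf ⟨hs.1, hs.2.trans hy.2.le⟩, div_eq_mul_inv, ← Real.rpow_neg (by linarith [hs.2]),
        neg_sub]
    rw [e1, hv.integral_mul_sub_rpow (by linarith) hy.1.le, ← integral_mul_sub_rpow_eq
      (by linarith) hy.1.le hy.2.le, show 1 - α + 4 = 5 - α by ring, div_eq_inv_mul]
    ring_nf
  have hw := hv.intervalIntegrable a b
  have d1 : ∀ y, HasDerivAt (fun y => ((2 - α) * (3 - α) * (4 - α) * (5 - α))⁻¹ *
        ∫ s in a..b, w s * max (y - s) 0 ^ (5 - α))
      (((2 - α) * (3 - α) * (4 - α))⁻¹ * ∫ s in a..b, w s * max (y - s) 0 ^ (4 - α)) y := by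
    intro y
    refine ((hasDerivAt_integral_mul_max_rpow (by linarith) hw y).const_mul _).congr_deriv ?_
    rw [show 5 - α - 1 = 4 - α by ring]
    field_simp
  have d2 : ∀ y, HasDerivAt (fun y => ((2 - α) * (3 - α) * (4 - α))⁻¹ *
        ∫ s in a..b, w s * max (y - s) 0 ^ (4 - α))
      (((2 - α) * (3 - α))⁻¹ * ∫ s in a..b, w s * max (y - s) 0 ^ (3 - α)) y := by
    intro y
    refine ((hasDerivAt_integral_mul_max_rpow (by linarith) hw y).const_mul _).congr_deriv ?_
    rw [show 4 - α - 1 = 3 - α by ring]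
    field_simp
  rw [leftRL, hev.iteratedDeriv_eq, iteratedDeriv_succ, iteratedDeriv_one,
    funext fun y => (d1 y).deriv, (d2 x).deriv, hΓ]
  field_simp

end HasFourthDeriv

/-- Second-order consistency of the one-sided difference operator. -/
theorem exists_abs_leftOp_sub_leftRL_le {α a b : ℝ} (h1 : 1 < α) (h2 : α < 2) (hab : a < b) :
    ∃ C : ℝ, 0 < C ∧ ∀ (V : ℝ) (v w f : ℝ → ℝ), HasFourthDeriv a V v w → EqOn f v (Icc a b) →
      ∀ (M : ℕ) (h : ℝ), h = (b - a) / M → ∀ j : ℕ, 1 ≤ j → j < M →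
        |leftOp α h (fun i => f (a + i * h)) j - leftRL a α f (a + j * h)| ≤ C * V * h ^ 2 := by
  obtain ⟨C, hC, hK⟩ := exists_abs_peanoKernel_le h1 h2
  -- The second factor bounds the integral of `(x + 2h - s)^(1 - α)` over `[a, x + h]`.
  refine ⟨C * ((3 * (b - a)) ^ (2 - α) / (2 - α)), ?_, ?_⟩
  · have : 0 < (3 * (b - a)) ^ (2 - α) := Real.rpow_pos_of_pos (by linarith) _
    have : 0 < 2 - α := by linarith
    positivity
  intro V v w f hv hf M h hh j hj hjM
  have hV : 0 ≤ V := (abs_nonneg _).trans (hv.bound 0)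
  have hM : (0 : ℝ) < M := by exact_mod_cast (by omega : 0 < M)
  have h0 : 0 < h := by rw [hh]; exact div_pos (by linarith) hM
  have hMh : (M : ℝ) * h = b - a := by rw [hh]; field_simp
  have hj1 : (1 : ℝ) ≤ j := by exact_mod_cast hj
  have hjM' : (j : ℝ) + 1 ≤ M := by exact_mod_cast hjM
  have hjh : ((j : ℝ) + 1) * h ≤ b - a := by rw [← hMh]; gcongr
  obtain ⟨x, hx⟩ : ∃ x, x = a + j * h := ⟨_, rfl⟩
  have hax : a + h ≤ x := by rw [hx]; nlinarith
  have hxb : x + h ≤ b := by rw [hx]; linarith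
  have hh_le : h ≤ b - a := by linarith
  have hw := hv.intervalIntegrable a (x + h)
  -- The integral runs to `x + h`, as the shifted operator reaches one node beyond `x`; the
  -- truncated kernel vanishes there.
  have hRL : leftRL a α f x =
      ∫ s in a..(x + h), w s * (max (x - s) 0 ^ (3 - α) / Real.Gamma (4 - α)) := by
    rw [hv.leftRL_eq h1 h2 ⟨by linarith, by linarith⟩ hf,
      ← integral_mul_sub_rpow_eq (by linarith) (by linarith) (by linarith : x ≤ b),
      integral_mul_sub_rpow_eq (by linarith) (by linarith) (by linarith : x ≤ x + h),
      ← intervalIntegral.integral_div]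
    exact intervalIntegral.integral_congr fun s _ => by simp only [mul_div_assoc]
  have hcont : ∀ c : ℝ, Continuous fun s : ℝ => max (c - s) 0 ^ 3 / 6 := fun c => by fun_prop
  have hOp : leftOp α h (fun i => f (a + i * h)) j =
      ∫ s in a..(x + h), w s * (1 / h ^ α *
        ∑ l ∈ range (j + 2), kappa α l * (max (x + (1 - l) * h - s) 0 ^ 3 / 6)) := by
    have e1 : ∀ l ∈ range (j + 2), kappa α l * f (a + ((j + 1 - l : ℕ) : ℝ) * h) =
        ∫ s in a..(x + h), w s * (kappa α l * (max (x + (1 - l) * h - s) 0 ^ 3 / 6)) := by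
      intro l hl
      have hl' : l ≤ j + 1 := by have := Finset.mem_range.1 hl; omega
      have hl'' : (l : ℝ) ≤ j + 1 := by exact_mod_cast hl'
      have hl0 : (0 : ℝ) ≤ l := l.cast_nonneg
      have e2 : a + ((j + 1 - l : ℕ) : ℝ) * h = x + (1 - l) * h := by
        rw [Nat.cast_sub hl', hx]; push_cast; ring
      have e3 : a ≤ x + (1 - l) * h := by rw [hx]; nlinarith
      have e4 : x + (1 - l) * h ≤ x + h := by nlinarith
      rw [e2, hf ⟨e3, e4.trans hxb⟩, hv.eq_integral_max e3 e4,
        ← intervalIntegral.integral_const_mul]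
      exact intervalIntegral.integral_congr fun s _ => by ring
    rw [leftOp, Finset.sum_congr rfl e1, ← intervalIntegral.integral_finsetSum,
      ← intervalIntegral.integral_const_mul]
    · refine intervalIntegral.integral_congr fun s _ => ?_
      simp only [← Finset.mul_sum]
      ring
    · intro l _
      exact hw.mul_continuousOn ((hcont _).const_mul (kappa α l)).continuousOn
  rw [← hx, hOp, hRL, ← intervalIntegral.integral_sub]
  rotate_left
  · refine hw.mul_continuousOn (Continuous.continuousOn ?_)
    exact continuous_const.mul (continuous_finsetSum _ fun l _ => (hcont _).const_mul _)
  · exact hw.mul_continuousOn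
      ((continuous_max_sub_rpow (by linarith : 0 ≤ 3 - α) x).div_const _).continuousOn
  have hexp : -1 < 1 - α := by linarith
  -- With `y = (x - s)/h` both kernels scale by `h^(3 - α)`, and `h^(3 - α) (y + 2)^(1 - α) = h² (x
  -- + 2h - s)^(1 - α)`.
  have hbound : ∀ s ∈ Ioc a (x + h),
      ‖w s * (1 / h ^ α * ∑ l ∈ range (j + 2), kappa α l * (max (x + (1 - l) * h - s) 0 ^ 3 / 6)) -
        w s * (max (x - s) 0 ^ (3 - α) / Real.Gamma (4 - α))‖ ≤
      V * C * h ^ 2 * (x + 2 * h - s) ^ (1 - α) := by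
    intro s hs
    obtain ⟨y, hy⟩ : ∃ y, y = (x - s) / h := ⟨_, rfl⟩
    have hyh : x - s = y * h := by rw [hy]; field_simp
    have hy1 : -1 ≤ y := by rw [hy, le_div_iff₀ h0]; linarith [hs.2]
    have hyj : y + 1 < ((j + 2 : ℕ) : ℝ) := by
      have : y < j + 1 := by
        rw [hy, div_lt_iff₀ h0, hx]
        nlinarith [hs.1]
      push_cast; linarith
    have hKy := hK y hy1 (j + 2) hyj
    have m1 : ∀ l : ℕ, max (x + (1 - l) * h - s) 0 = max (y + 1 - l) 0 * h := by
      intro l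
      rw [max_mul_of_nonneg _ _ h0.le, zero_mul]
      congr 1
      linear_combination hyh
    have m2 : max (x - s) 0 = max y 0 * h := by
      rw [max_mul_of_nonneg _ _ h0.le, zero_mul, hyh]
    have m3 : x + 2 * h - s = (y + 2) * h := by linear_combination hyh
    have p1 : 1 / h ^ α * h ^ 3 = h ^ (3 - α) := by
      rw [Real.rpow_sub h0, ← Real.rpow_natCast]; push_cast; ring
    have p2 : h ^ (3 - α) = h ^ 2 * h ^ (1 - α) := by
      rw [← Real.rpow_natCast, ← Real.rpow_add h0]; push_cast; ring_nf
    have key : w s * (1 / h ^ α * ∑ l ∈ range (j + 2),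
          kappa α l * (max (x + (1 - l) * h - s) 0 ^ 3 / 6)) -
        w s * (max (x - s) 0 ^ (3 - α) / Real.Gamma (4 - α)) =
        w s * (h ^ (3 - α) * (∑ l ∈ range (j + 2), kappa α l * (max (y + 1 - l) 0 ^ 3 / 6) -
          max y 0 ^ (3 - α) / Real.Gamma (4 - α))) := by
      have : ∑ l ∈ range (j + 2), kappa α l * (max (x + (1 - l) * h - s) 0 ^ 3 / 6) =
          h ^ 3 * ∑ l ∈ range (j + 2), kappa α l * (max (y + 1 - l) 0 ^ 3 / 6) := by
        rw [Finset.mul_sum]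
        exact Finset.sum_congr rfl fun l _ => by rw [m1]; ring
      rw [this, m2, Real.mul_rpow (le_max_right _ _) h0.le, ← p1]
      ring
    rw [key, Real.norm_eq_abs, abs_mul, abs_mul, abs_of_pos (by positivity : 0 < h ^ (3 - α)), m3,
      Real.mul_rpow (by linarith) h0.le]
    calc _ ≤ V * (h ^ (3 - α) * (C * (y + 2) ^ (1 - α))) := by
          gcongr
          exact hv.bound s
      _ = _ := by rw [p2]; ring
  have hle : a ≤ x + h := by linarith
  rw [← Real.norm_eq_abs]
  refine (intervalIntegral.norm_integral_le_of_norm_le hle (ae_of_all _ hbound)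
    ((intervalIntegrable_sub_rpow hexp _ _ _).const_mul _)).trans ?_
  rw [intervalIntegral.integral_const_mul,
    intervalIntegral.integral_comp_sub_left (fun s => s ^ (1 - α)) (x + 2 * h),
    integral_rpow (Or.inl hexp), show 1 - α + 1 = 2 - α by ring]
  have t1 : (x + 2 * h - a) ^ (2 - α) ≤ (3 * (b - a)) ^ (2 - α) :=
    Real.rpow_le_rpow (by linarith) (by linarith) (by linarith)
  have t2 : 0 ≤ (x + 2 * h - (x + h)) ^ (2 - α) := Real.rpow_nonneg (by linarith) _
  have t3 : 0 < 2 - α := by linarith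
  calc _ ≤ V * C * h ^ 2 * ((3 * (b - a)) ^ (2 - α) / (2 - α)) := by
        gcongr
        linarith
    _ = _ := by ring

end RieszScheme

end

/-! ### Two-sided consistency and classical difference quotients -/

section

open Filter Topology Finset MeasureTheory Set

namespace RieszScheme

theorem measurable_of_boundedVariationOn {w : ℝ → ℝ} (h : BoundedVariationOn w univ) :
    Measurable w := by
  obtain ⟨p, q, hp, hq, rfl⟩ := h.locallyBoundedVariationOn.exists_monotoneOn_sub_monotoneOn
  exact (monotoneOn_univ.1 hp).measurable.sub (monotoneOn_univ.1 hq).measurable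

/-- A function of variation at most `V` with an integral equal to zero is bounded by `V`. -/
theorem abs_le_of_eVariationOn_le {w : ℝ → ℝ} {V : NNReal} (h : eVariationOn w univ ≤ V)
    {c : ℝ} (hc : ∫ s in c..(c + 1), w s = 0) (x : ℝ) : |w x| ≤ V := by
  have hbv : BoundedVariationOn w univ := ne_top_of_le_ne_top ENNReal.coe_ne_top h
  have hsub : ∀ y, |w x - w y| ≤ V := by
    intro y
    have h1 := hbv.dist_le (mem_univ x) (mem_univ y)
    rw [Real.dist_eq] at h1
    exact h1.trans (ENNReal.toReal_le_coe_of_le_coe h)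
  have hmeas := measurable_of_boundedVariationOn hbv
  have hint : IntervalIntegrable w volume c (c + 1) := by
    rw [intervalIntegrable_iff]
    refine Measure.integrableOn_of_bounded (M := |w x| + V) (by simp)
      hmeas.aestronglyMeasurable (ae_of_all _ fun s => ?_)
    have := hsub s
    rw [Real.norm_eq_abs]
    have h2 := abs_sub_abs_le_abs_sub (w s) (w x)
    rw [abs_sub_comm] at h2
    linarith
  have hle : c ≤ c + 1 := by linarith
  have hconst : ∀ d : ℝ, ∫ _ in c..(c + 1), d = d := fun d => by simp
  have h1 : w x - V ≤ 0 := by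
    rw [← hc, ← hconst (w x - V)]
    refine intervalIntegral.integral_mono_on hle (by simp) hint fun s _ => ?_
    have := (abs_le.1 (hsub s)).2
    linarith
  have h2 : 0 ≤ w x + V := by
    rw [← hc, ← hconst (w x + V)]
    refine intervalIntegral.integral_mono_on hle hint (by simp) fun s _ => ?_
    have := (abs_le.1 (hsub s)).1
    linarith
  rw [abs_le]
  constructor <;> linarith

theorem zeroExt_eqOn (a b : ℝ) (f : ℝ → ℝ) : EqOn f (zeroExt a b f) (Icc a b) := fun x hx => by
  rw [zeroExt, indicator_of_mem hx]

/-- Bounded variation serves to make `w` measurable and bounded by `V`. -/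
theorem hasFourthDeriv_zeroExt {a b : ℝ} {f w : ℝ → ℝ} {V : NNReal}
    (hf : ContDiff ℝ 3 (zeroExt a b f)) (hw : eVariationOn w univ ≤ V)
    (hi : ∀ x y : ℝ, iteratedDeriv 3 (zeroExt a b f) y - iteratedDeriv 3 (zeroExt a b f) x =
      ∫ s in x..y, w s) : HasFourthDeriv a V (zeroExt a b f) w := by
  have hz : ∀ x < a, zeroExt a b f x = 0 := fun x hx => by
    rw [zeroExt, indicator_of_notMem fun h => absurd h.1 (not_le.2 hx)]
  have hd : ∀ x < a, iteratedDeriv 3 (zeroExt a b f) x = 0 := by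
    intro x hx
    have : zeroExt a b f =ᶠ[𝓝 x] fun _ => 0 := by
      filter_upwards [Iio_mem_nhds hx] with y hy using hz y hy
    rw [this.iteratedDeriv_eq]
    simp
  -- On `[a - 2, a - 1]` the third derivative vanishes, so `w` has integral zero there.
  refine ⟨hf, hz, measurable_of_boundedVariationOn (ne_top_of_le_ne_top ENNReal.coe_ne_top hw),
    abs_le_of_eVariationOn_le (c := a - 2) hw ?_, hi⟩
  rw [← hi, hd _ (by linarith), hd _ (by linarith), sub_zero]

theorem HasFourthDeriv.comp_neg {a b V : ℝ} {v w : ℝ → ℝ} (hv : HasFourthDeriv a V v w)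
    (hb : ∀ x > b, v x = 0) :
    HasFourthDeriv (-b) V (fun x => v (-x)) fun x => w (-x) := by
  refine ⟨hv.contDiff.comp contDiff_neg, fun x hx => hb _ (by linarith),
    hv.measurable.comp measurable_neg, fun x => hv.bound _, fun x y => ?_⟩
  rw [iteratedDeriv_comp_neg, iteratedDeriv_comp_neg, intervalIntegral.integral_comp_neg,
    ← hv.integral_eq]
  norm_num
  ring

/-- Substitute `s ↦ -s`; two derivatives produce no sign. -/
theorem rightRL_eq_leftRL (b α : ℝ) (f : ℝ → ℝ) (x : ℝ) :
    rightRL b α f x = leftRL (-b) α (fun s => f (-s)) (-x) := by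
  rw [rightRL, leftRL]
  congr 1
  have : (fun y => ∫ s in y..b, f s / (s - y) ^ (α - 1)) =
      fun y => (fun z => ∫ s in (-b)..z, f (-s) / (z - s) ^ (α - 1)) (-y) := by
    ext y
    have := intervalIntegral.integral_comp_neg (a := -b) (b := -y)
      (fun s => f s / (s - y) ^ (α - 1))
    simp only [neg_neg] at this
    rw [← this]
    refine intervalIntegral.integral_congr fun s _ => ?_
    ring_nf
  have h2 := iteratedDeriv_comp_neg 2 (fun z => ∫ s in (-b)..z, f (-s) / (z - s) ^ (α - 1)) x
  rw [this]
  simpa using h2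

theorem leftOp_congr {α h : ℝ} {v v' : ℕ → ℝ} {j : ℕ} (hv : ∀ i ≤ j + 1, v i = v' i) :
    leftOp α h v j = leftOp α h v' j := by
  rw [leftOp, leftOp]
  congr 1
  exact Finset.sum_congr rfl fun l _ => by rw [hv _ (Nat.sub_le _ _)]

/-- The right half is the left estimate for the reflected function on `(-b, -a)` at node `M - j`. -/
theorem exists_abs_rieszOp_sub_rieszDeriv_le {α a b : ℝ} (h1 : 1 < α) (h2 : α < 2) (hab : a < b) :
    ∃ C : ℝ, 0 < C ∧ ∀ (V : ℝ) (w f : ℝ → ℝ), HasFourthDeriv a V (zeroExt a b f) w →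
      ∀ (M : ℕ) (h : ℝ), h = (b - a) / M → ∀ j : ℕ, 1 ≤ j → j < M →
        |rieszOp α h M (fun i => f (a + i * h)) j - rieszDeriv a b α f (a + j * h)| ≤
          C * V * h ^ 2 := by
  obtain ⟨C1, hC1, hl⟩ := exists_abs_leftOp_sub_leftRL_le h1 h2 hab
  obtain ⟨C2, hC2, hr⟩ := exists_abs_leftOp_sub_leftRL_le (a := -b) (b := -a) h1 h2 (by linarith)
  have hc := rieszConst_pos h1 h2
  refine ⟨rieszConst α * (C1 + C2), by positivity, fun V w f hv M h hh j hj hjM => ?_⟩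
  have hM : (M : ℝ) ≠ 0 := by
    have : (0 : ℝ) < M := by exact_mod_cast (by omega : 0 < M)
    exact this.ne'
  have hMh : (M : ℝ) * h = b - a := by rw [hh]; field_simp
  have e1 := hl V _ w f hv (zeroExt_eqOn a b f) M h hh j hj hjM
  have e2 := hr V _ _ (fun x => f (-x)) (hv.comp_neg (b := b) fun x hx => by
      rw [zeroExt, indicator_of_notMem fun h => absurd h.2 (not_le.2 hx)])
    (fun x hx => zeroExt_eqOn a b f ⟨by linarith [hx.2], by linarith [hx.1]⟩) M h
    (by rw [hh]; ring) (M - j) (by omega) (by omega)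
  have hcast : ((M - j : ℕ) : ℝ) = M - j := Nat.cast_sub hjM.le
  have hop : leftOp α h (fun i => f (-(-b + i * h))) (M - j) =
      rightOp α h M (fun i => f (a + i * h)) j := by
    rw [rightOp_eq_leftOp_reverse hj _ hjM.le]
    refine leftOp_congr fun i hi => ?_
    have hi' : i ≤ M := by omega
    rw [Nat.cast_sub hi']
    congr 1
    linear_combination -hMh
  rw [hop, show -b + ((M - j : ℕ) : ℝ) * h = -(a + j * h) by
    rw [hcast]; linear_combination hMh, ← rightRL_eq_leftRL] at e2
  rw [rieszOp, rieszDeriv, ← mul_sub, abs_mul, abs_of_pos hc, add_sub_add_comm]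
  calc _ ≤ rieszConst α * (C1 * V * h ^ 2 + C2 * V * h ^ 2) := by
        gcongr
        exact (abs_add_le _ _).trans (add_le_add e1 e2)
    _ = _ := by ring

/-! Elementary difference quotients. -/

/-- Mean value inequality on an interval. -/
theorem abs_sub_le_of_hasDerivWithinAt {g g' : ℝ → ℝ} {a b C : ℝ}
    (hg : ∀ x ∈ Icc a b, HasDerivWithinAt g (g' x) (Icc a b) x)
    (hC : ∀ x ∈ Icc a b, |g' x| ≤ C) {x y : ℝ} (hx : x ∈ Icc a b) (hy : y ∈ Icc a b) :
    |g y - g x| ≤ C * |y - x| :=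
  (convex_Icc a b).norm_image_sub_le_of_norm_hasDerivWithin_le hg hC hx hy

/-- As a function of `s = h`, the error vanishes at zero. Two differentiations in `s` lead to `v2 (x
+ s) - v2 (x - s)`, and each mean value inequality gains a factor `h`. -/
theorem abs_symm_sub_le {v v1 v2 v3 : ℝ → ℝ} {x h B : ℝ} (h0 : 0 ≤ h)
    (d0 : ∀ y ∈ Icc (x - h) (x + h), HasDerivWithinAt v (v1 y) (Icc (x - h) (x + h)) y)
    (d1 : ∀ y ∈ Icc (x - h) (x + h), HasDerivWithinAt v1 (v2 y) (Icc (x - h) (x + h)) y)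
    (d2 : ∀ y ∈ Icc (x - h) (x + h), HasDerivWithinAt v2 (v3 y) (Icc (x - h) (x + h)) y)
    (hB : ∀ y ∈ Icc (x - h) (x + h), |v3 y| ≤ B) :
    |v (x + h) - v (x - h) - 2 * h * v1 x| ≤ 2 * B * h ^ 3 := by
  have hB0 : 0 ≤ B := (abs_nonneg _).trans (hB x ⟨by linarith, by linarith⟩)
  have mp : MapsTo (fun s : ℝ => x + s) (Icc 0 h) (Icc (x - h) (x + h)) :=
    fun s hs => ⟨by linarith [hs.1], by linarith [hs.2]⟩
  have mm : MapsTo (fun s : ℝ => x - s) (Icc 0 h) (Icc (x - h) (x + h)) :=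
    fun s hs => ⟨by linarith [hs.2], by linarith [hs.1]⟩
  have plus : ∀ (g g' : ℝ → ℝ), (∀ y ∈ Icc (x - h) (x + h),
      HasDerivWithinAt g (g' y) (Icc (x - h) (x + h)) y) → ∀ s ∈ Icc 0 h,
      HasDerivWithinAt (fun s => g (x + s)) (g' (x + s)) (Icc 0 h) s := by
    intro g g' hg s hs
    refine ((hg _ (mp hs)).comp s ((hasDerivWithinAt_id s _).const_add x) mp).congr_deriv ?_
    simp
  have minus : ∀ (g g' : ℝ → ℝ), (∀ y ∈ Icc (x - h) (x + h),
      HasDerivWithinAt g (g' y) (Icc (x - h) (x + h)) y) → ∀ s ∈ Icc 0 h,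
      HasDerivWithinAt (fun s => g (x - s)) (-g' (x - s)) (Icc 0 h) s := by
    intro g g' hg s hs
    refine ((hg _ (mm hs)).comp s ((hasDerivWithinAt_id s _).const_sub x) mm).congr_deriv ?_
    simp
  have z0 : (0 : ℝ) ∈ Icc 0 h := ⟨le_rfl, h0⟩
  have b2 : ∀ s ∈ Icc 0 h, |v2 (x + s) - v2 (x - s)| ≤ 2 * B * h := by
    intro s hs
    refine (abs_sub_le_of_hasDerivWithinAt d2 hB (mm hs) (mp hs)).trans ?_
    rw [show x + s - (x - s) = 2 * s by ring, abs_of_nonneg (by linarith [hs.1])]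
    nlinarith [hs.2]
  have b1 : ∀ s ∈ Icc 0 h, |v1 (x + s) + v1 (x - s) - 2 * v1 x| ≤ 2 * B * h ^ 2 := by
    intro s hs
    have := abs_sub_le_of_hasDerivWithinAt (g := fun s => v1 (x + s) + v1 (x - s))
      (g' := fun s => v2 (x + s) - v2 (x - s))
      (fun s hs => (plus v1 v2 d1 s hs).add (minus v1 v2 d1 s hs)) b2 z0 hs
    simp only [add_zero, sub_zero] at this
    rw [show v1 (x + s) + v1 (x - s) - 2 * v1 x = v1 (x + s) + v1 (x - s) - (v1 x + v1 x) by ring]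
    refine this.trans ?_
    rw [abs_of_nonneg hs.1]
    calc 2 * B * h * s ≤ 2 * B * h * h := by gcongr; exact hs.2
      _ = _ := by ring
  have := abs_sub_le_of_hasDerivWithinAt (g := fun s => v (x + s) - v (x - s) - 2 * s * v1 x)
    (g' := fun s => v1 (x + s) + v1 (x - s) - 2 * v1 x)
    (fun s hs => (((plus v v1 d0 s hs).sub (minus v v1 d0 s hs)).sub
      (((hasDerivWithinAt_id s _).const_mul 2).mul_const (v1 x))).congr_deriv (by simp))
    b1 z0 (y := h) ⟨h0, le_rfl⟩
  simp only [add_zero, sub_zero, sub_self, mul_zero, zero_mul] at this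
  refine this.trans ?_
  rw [abs_of_nonneg h0]
  apply le_of_eq
  ring

/-- Let the right endpoint `r` vary: the derivative of the error is half the Taylor remainder of
`g1` about `r`, of size `τ²`. -/
theorem abs_trapezoid_sub_le {g g1 g2 g3 : ℝ → ℝ} {t τ C : ℝ} (h0 : 0 ≤ τ)
    (d0 : ∀ y ∈ Icc t (t + τ), HasDerivWithinAt g (g1 y) (Icc t (t + τ)) y)
    (d1 : ∀ y ∈ Icc t (t + τ), HasDerivWithinAt g1 (g2 y) (Icc t (t + τ)) y)
    (d2 : ∀ y ∈ Icc t (t + τ), HasDerivWithinAt g2 (g3 y) (Icc t (t + τ)) y)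
    (hC : ∀ y ∈ Icc t (t + τ), |g3 y| ≤ C) :
    |g (t + τ) - g t - τ * ((g1 t + g1 (t + τ)) / 2)| ≤ C * τ ^ 3 := by
  have ht : t ∈ Icc t (t + τ) := ⟨le_rfl, by linarith⟩
  have htτ : t + τ ∈ Icc t (t + τ) := ⟨by linarith, le_rfl⟩
  have hC0 : 0 ≤ C := (abs_nonneg _).trans (hC t ht)
  have dist_le : ∀ r ∈ Icc t (t + τ), ∀ q ∈ Icc t (t + τ), |r - q| ≤ τ := fun r hr q hq => by
    rw [abs_le]; constructor <;> linarith [hr.1, hr.2, hq.1, hq.2]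
  have b1 : ∀ r ∈ Icc t (t + τ), |g1 r - g1 t - (r - t) * g2 r| ≤ C * τ ^ 2 := by
    intro r hr
    have h2 : ∀ q ∈ Icc t (t + τ), |g2 q - g2 r| ≤ C * τ := fun q hq =>
      (abs_sub_le_of_hasDerivWithinAt d2 hC hr hq).trans (by gcongr; exact dist_le q hq r hr)
    have := abs_sub_le_of_hasDerivWithinAt (g := fun q => g1 q - q * g2 r)
      (g' := fun q => g2 q - g2 r)
      (fun q hq => ((d1 q hq).sub ((hasDerivWithinAt_id q _).mul_const (g2 r))).congr_deriv
        (by simp)) h2 ht hr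
    rw [show g1 r - g1 t - (r - t) * g2 r = g1 r - r * g2 r - (g1 t - t * g2 r) by ring]
    refine this.trans ?_
    calc _ ≤ C * τ * τ := by gcongr; exact dist_le r hr t ht
      _ = _ := by ring
  have b0 : ∀ r ∈ Icc t (t + τ), |(g1 r - g1 t - (r - t) * g2 r) / 2| ≤ C * τ ^ 2 := by
    intro r hr
    rw [abs_div, abs_two]
    have := b1 r hr
    have := abs_nonneg (g1 r - g1 t - (r - t) * g2 r)
    linarith
  have := abs_sub_le_of_hasDerivWithinAt
    (g := fun r => g r - (r - t) * ((g1 t + g1 r) / 2))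
    (g' := fun r => (g1 r - g1 t - (r - t) * g2 r) / 2)
    (fun r hr => ((d0 r hr).sub (((hasDerivWithinAt_id r _).sub_const t).mul
      (((d1 r hr).const_add (g1 t)).div_const 2))).congr_deriv (by simp; ring)) b0 ht htτ
  rw [show g (t + τ) - g t - τ * ((g1 t + g1 (t + τ)) / 2) =
    g (t + τ) - (t + τ - t) * ((g1 t + g1 (t + τ)) / 2) - (g t - (t - t) * ((g1 t + g1 t) / 2)) by
    ring]
  refine this.trans ?_
  rw [show t + τ - t = τ by ring, abs_of_nonneg h0]
  apply le_of_eq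
  ring

/-- Compare with the tangent at `m`; its slope cancels in the average. -/
theorem abs_midpoint_sub_le {g g1 g2 : ℝ → ℝ} {m σ C : ℝ} (h0 : 0 ≤ σ)
    (d0 : ∀ y ∈ Icc (m - σ) (m + σ), HasDerivWithinAt g (g1 y) (Icc (m - σ) (m + σ)) y)
    (d1 : ∀ y ∈ Icc (m - σ) (m + σ), HasDerivWithinAt g1 (g2 y) (Icc (m - σ) (m + σ)) y)
    (hC : ∀ y ∈ Icc (m - σ) (m + σ), |g2 y| ≤ C) :
    |(g (m - σ) + g (m + σ)) / 2 - g m| ≤ C * σ ^ 2 := by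
  have hm : m ∈ Icc (m - σ) (m + σ) := ⟨by linarith, by linarith⟩
  have hC0 : 0 ≤ C := (abs_nonneg _).trans (hC m hm)
  have mp : m + σ ∈ Icc (m - σ) (m + σ) := ⟨by linarith, le_rfl⟩
  have mm : m - σ ∈ Icc (m - σ) (m + σ) := ⟨le_rfl, by linarith⟩
  have b1 : ∀ y ∈ Icc (m - σ) (m + σ), |g1 y - g1 m| ≤ C * σ := fun y hy =>
    (abs_sub_le_of_hasDerivWithinAt d1 hC hm hy).trans (by
      gcongr
      rw [abs_le]; constructor <;> linarith [hy.1, hy.2])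
  have key : ∀ y ∈ Icc (m - σ) (m + σ), |g y - y * g1 m - (g m - m * g1 m)| ≤ C * σ * |y - m| :=
    fun y hy => abs_sub_le_of_hasDerivWithinAt (g := fun y => g y - y * g1 m)
      (g' := fun y => g1 y - g1 m)
      (fun q hq => ((d0 q hq).sub ((hasDerivWithinAt_id q _).mul_const (g1 m))).congr_deriv
        (by simp)) b1 hm hy
  have k1 := key _ mp
  have k2 := key _ mm
  rw [show m + σ - m = σ by ring, abs_of_nonneg h0] at k1
  rw [show m - σ - m = -σ by ring, abs_neg, abs_of_nonneg h0] at k2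
  rw [abs_le] at k1 k2 ⊢
  constructor <;> nlinarith [k1.1, k1.2, k2.1, k2.2]

/-- Second-order consistency of the central difference. -/
theorem abs_centralDiff_sub_deriv_le {a b V h : ℝ} {f w : ℝ → ℝ}
    (hv : HasFourthDeriv a V (zeroExt a b f) w) {j : ℕ} (hh : 0 < h) (hj : 1 ≤ j)
    (hjb : a + (j + 1) * h ≤ b) :
    |centralDiff h (fun i => f (a + i * h)) j - deriv f (a + j * h)| ≤ V * (b - a) * h ^ 2 := by
  have hj1 : (1 : ℝ) ≤ j := by exact_mod_cast hj
  obtain ⟨x, hx⟩ : ∃ x, x = a + j * h := ⟨_, rfl⟩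
  have hxa : a ≤ x - h := by rw [hx]; nlinarith
  have hxb : x + h ≤ b := by rw [hx]; linarith
  have heq := zeroExt_eqOn a b f
  set v := zeroExt a b f with hvdef
  have hV : 0 ≤ V := (abs_nonneg _).trans (hv.bound 0)
  have hderiv : deriv f x = iteratedDeriv 1 v x := by
    rw [iteratedDeriv_one]
    refine EventuallyEq.deriv_eq ?_
    filter_upwards [Ioo_mem_nhds (by linarith : a < x) (by linarith : x < b)] with y hy
    exact heq ⟨hy.1.le, hy.2.le⟩
  -- The third derivative vanishes at `a`, so it is bounded by `V` times the length.
  have hB : ∀ y ∈ Icc (x - h) (x + h), |iteratedDeriv 3 v y| ≤ V * (b - a) := by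
    intro y hy
    have hay : a ≤ y := hxa.trans hy.1
    rw [hv.iteratedDeriv_three_eq_integral, ← Real.norm_eq_abs]
    refine (intervalIntegral.norm_integral_le_of_norm_le_const
      fun s _ => hv.bound s).trans ?_
    rw [abs_of_nonneg (by linarith)]
    gcongr
    exact hy.2.trans hxb
  have key := abs_symm_sub_le hh.le
    (fun y _ => (hv.hasDerivAt_iteratedDeriv (k := 0) (by norm_num) y).hasDerivWithinAt)
    (fun y _ => (hv.hasDerivAt_iteratedDeriv (k := 1) (by norm_num) y).hasDerivWithinAt)
    (fun y _ => (hv.hasDerivAt_iteratedDeriv (k := 2) (by norm_num) y).hasDerivWithinAt) hB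
  simp only [iteratedDeriv_zero, zero_add] at key
  rw [← heq ⟨by linarith, hxb⟩, ← heq ⟨hxa, by linarith⟩, ← hderiv] at key
  have e1 : centralDiff h (fun i => f (a + i * h)) j = (f (x + h) - f (x - h)) / (2 * h) := by
    rw [centralDiff, halfDiff, halfDiff, Nat.add_sub_cancel, Nat.cast_sub hj]
    push_cast
    rw [show a + ((j : ℝ) + 1) * h = x + h by rw [hx]; ring,
      show a + ((j : ℝ) - 1) * h = x - h by rw [hx]; ring]
    field_simp
    ring
  rw [← hx, e1]
  have e2 : (f (x + h) - f (x - h)) / (2 * h) - deriv f x =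
      (f (x + h) - f (x - h) - 2 * h * deriv f x) / (2 * h) := by field_simp
  rw [e2, abs_div, abs_of_pos (by positivity : 0 < 2 * h), div_le_iff₀ (by positivity)]
  refine key.trans (le_of_eq ?_)
  ring

end RieszScheme

end

/-! ### Energy estimate and residual of the exact solution -/

section

open Filter Topology Finset MeasureTheory Set

namespace RieszScheme

/-- The spatial part of the scheme. -/
noncomputable def spatialOp (α K Kα h : ℝ) (M : ℕ) (v : ℕ → ℝ) (j : ℕ) : ℝ :=
  K * centralDiff h v j - Kα * rieszOp α h M v j

theorem spatialOp_linear (α K Kα h : ℝ) (M : ℕ) (c d : ℝ) (v w : ℕ → ℝ) (j : ℕ) :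
    spatialOp α K Kα h M (fun i => c * v i + d * w i) j =
      c * spatialOp α K Kα h M v j + d * spatialOp α K Kα h M w j := by
  have hl : leftOp α h (fun i => c * v i + d * w i) j = c * leftOp α h v j + d * leftOp α h w j := by
    simp only [leftOp, Finset.mul_sum, ← Finset.sum_add_distrib]
    exact Finset.sum_congr rfl fun l _ => by ring
  have hr : rightOp α h M (fun i => c * v i + d * w i) j =
      c * rightOp α h M v j + d * rightOp α h M w j := by
    simp only [rightOp, Finset.mul_sum, ← Finset.sum_add_distrib]
    exact Finset.sum_congr rfl fun l _ => by ring
  rw [spatialOp, spatialOp, spatialOp, rieszOp, rieszOp, rieszOp, hl, hr]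
  simp only [centralDiff, halfDiff]
  ring

theorem sum_mul_spatialOp_nonneg {α K Kα h : ℝ} (h1 : 1 < α) (h2 : α < 2) (hK : 0 < Kα)
    (hh : 0 < h) {M : ℕ} {v : ℕ → ℝ} (v0 : v 0 = 0) (vM : v M = 0) :
    0 ≤ ∑ j ∈ Finset.Icc 1 (M - 1), v j * spatialOp α K Kα h M v j := by
  have e : ∑ j ∈ Finset.Icc 1 (M - 1), v j * spatialOp α K Kα h M v j =
      K * ∑ j ∈ Finset.Icc 1 (M - 1), v j * centralDiff h v j -
        Kα * ∑ j ∈ Finset.Icc 1 (M - 1), v j * rieszOp α h M v j := by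
    rw [Finset.mul_sum, Finset.mul_sum, ← Finset.sum_sub_distrib]
    exact Finset.sum_congr rfl fun j _ => by rw [spatialOp]; ring
  rw [e, sum_mul_centralDiff_eq_zero v0 vM]
  have := mul_nonneg hK.le (neg_nonneg.2 (sum_mul_rieszOp_nonpos h1 h2 hh v0 vM))
  linarith

theorem gridNorm_nonneg (h : ℝ) (M : ℕ) (v : ℕ → ℝ) : 0 ≤ gridNorm h M v := Real.sqrt_nonneg _

theorem gridNorm_sq {h : ℝ} (hh : 0 ≤ h) (M : ℕ) (v : ℕ → ℝ) :
    gridNorm h M v ^ 2 = h * ∑ j ∈ Finset.Icc 1 (M - 1), v j ^ 2 :=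
  Real.sq_sqrt (mul_nonneg hh (Finset.sum_nonneg fun _ _ => sq_nonneg _))

theorem gridInner_le {h : ℝ} (hh : 0 ≤ h) (M : ℕ) (v w : ℕ → ℝ) :
    h * ∑ j ∈ Finset.Icc 1 (M - 1), v j * w j ≤ gridNorm h M v * gridNorm h M w := by
  have h1 := Real.sum_mul_le_sqrt_mul_sqrt (Finset.Icc 1 (M - 1)) v w
  rw [gridNorm, gridNorm, Real.sqrt_mul hh, Real.sqrt_mul hh]
  calc _ ≤ h * (√(∑ j ∈ Finset.Icc 1 (M - 1), v j ^ 2) * √(∑ j ∈ Finset.Icc 1 (M - 1), w j ^ 2)) := by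
        gcongr
    _ = (√h * √h) * (√(∑ j ∈ Finset.Icc 1 (M - 1), v j ^ 2) *
          √(∑ j ∈ Finset.Icc 1 (M - 1), w j ^ 2)) := by rw [Real.mul_self_sqrt hh]
    _ = _ := by ring

theorem gridNorm_le_of_abs_le {h l B : ℝ} (hh : 0 ≤ h) (hB : 0 ≤ B) {M : ℕ} (hl : M * h = l)
    {r : ℕ → ℝ} (hr : ∀ j, 1 ≤ j → j < M → |r j| ≤ B) : gridNorm h M r ≤ √l * B := by
  have hl0 : 0 ≤ l := by rw [← hl]; positivity
  rw [gridNorm]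
  refine Real.sqrt_le_iff.2 ⟨by positivity, ?_⟩
  rw [mul_pow, Real.sq_sqrt hl0]
  have h1 : ∑ j ∈ Finset.Icc 1 (M - 1), r j ^ 2 ≤ ∑ _ ∈ Finset.Icc 1 (M - 1), B ^ 2 := by
    refine Finset.sum_le_sum fun j hj => ?_
    rw [Finset.mem_Icc] at hj
    rw [← sq_abs]
    have := hr j hj.1 (by omega)
    gcongr
  rw [Finset.sum_const, Nat.card_Icc, nsmul_eq_mul, Nat.add_sub_cancel] at h1
  have h2 : ((M - 1 : ℕ) : ℝ) ≤ M := by exact_mod_cast Nat.sub_le M 1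
  calc _ ≤ h * (((M - 1 : ℕ) : ℝ) * B ^ 2) := by gcongr
    _ ≤ h * (M * B ^ 2) := by gcongr
    _ = _ := by rw [← hl]; ring

/-- The energy estimate for one Crank–Nicolson step. -/
theorem gridNorm_step_le {α K Kα h τ l B : ℝ} (h1 : 1 < α) (h2 : α < 2) (hK : 0 < Kα)
    (hh : 0 < h) (hτ : 0 < τ) (hB : 0 ≤ B) {M : ℕ} (hl : M * h = l) {e e' r : ℕ → ℝ}
    (e0 : e 0 = 0) (eM : e M = 0) (e0' : e' 0 = 0) (eM' : e' M = 0)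
    (heq : ∀ j, 1 ≤ j → j < M →
      (e' j - e j) / τ + spatialOp α K Kα h M (fun i => (e' i + e i) / 2) j = r j)
    (hr : ∀ j, 1 ≤ j → j < M → |r j| ≤ B) :
    gridNorm h M e' ≤ gridNorm h M e + τ * (√l * B) := by
  have hR := gridNorm_le_of_abs_le hh.le hB hl hr
  have hpos := sum_mul_spatialOp_nonneg (K := K) h1 h2 hK hh (M := M)
    (v := fun i => (e' i + e i) / 2) (by simp [e0, e0']) (by simp [eM, eM'])
  set L := spatialOp α K Kα h M (fun i => (e' i + e i) / 2) with hL
  have i1 := gridInner_le hh.le M r e'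
  have i2 := gridInner_le hh.le M r e
  -- The step is tested with `τ h (e' + e)`, which turns the time difference into a difference of
  -- squares.
  have hdiff : gridNorm h M e' ^ 2 - gridNorm h M e ^ 2 =
      τ * (h * ∑ j ∈ Finset.Icc 1 (M - 1), r j * e' j) +
        τ * (h * ∑ j ∈ Finset.Icc 1 (M - 1), r j * e j) -
        2 * τ * h * ∑ j ∈ Finset.Icc 1 (M - 1), (e' j + e j) / 2 * L j := by
    rw [gridNorm_sq hh.le, gridNorm_sq hh.le]
    simp only [Finset.mul_sum, ← Finset.sum_sub_distrib, ← Finset.sum_add_distrib]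
    refine Finset.sum_congr rfl fun j hj => ?_
    rw [Finset.mem_Icc] at hj
    have := heq j hj.1 (by omega)
    have e1 : e' j - e j = τ * (r j - L j) := by
      rw [← this]; field_simp; ring
    linear_combination (h * (e' j + e j)) * e1
  have hE := gridNorm_nonneg h M e
  have hE' := gridNorm_nonneg h M e'
  generalize gridNorm h M e = E at *
  generalize gridNorm h M e' = E' at *
  generalize gridNorm h M r = R at *
  have hle : (E' - E) * (E' + E) ≤ τ * (√l * B) * (E' + E) := by
    have t1 : 0 ≤ 2 * τ * h * ∑ j ∈ Finset.Icc 1 (M - 1), (e' j + e j) / 2 * L j :=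
      mul_nonneg (by positivity) hpos
    have t2 := mul_le_mul_of_nonneg_left i1 hτ.le
    have t3 := mul_le_mul_of_nonneg_left i2 hτ.le
    have t4 : τ * R * (E' + E) ≤ τ * (√l * B) * (E' + E) := by gcongr
    nlinarith
  -- Dividing by `E' + E` requires it to be nonzero.
  rcases (add_nonneg hE' hE).eq_or_lt with h0 | h0
  · have : E' = 0 := by linarith
    have : 0 ≤ τ * (√l * B) := by positivity
    linarith
  · have := le_of_mul_le_mul_right hle h0
    linarith

theorem hasDerivWithinAt_iteratedDerivWithin {g : ℝ → ℝ} {T : ℝ} (hT : 0 < T) {n k : ℕ}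
    (hg : ContDiffOn ℝ n g (Icc 0 T)) (hk : k < n) {t : ℝ} (ht : t ∈ Icc 0 T) :
    HasDerivWithinAt (iteratedDerivWithin k g (Icc 0 T))
      (iteratedDerivWithin (k + 1) g (Icc 0 T) t) (Icc 0 T) t := by
  rw [iteratedDerivWithin_succ]
  exact (hg.differentiableOn_iteratedDerivWithin (by exact_mod_cast hk)
    (uniqueDiffOn_Icc hT) t ht).hasDerivWithinAt

section

variable {a b T α K Kα : ℝ} {f : ℝ → ℝ → ℝ} {u0 : ℝ → ℝ} {u : ℝ → ℝ → ℝ}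

/-- The exact solution satisfies the semi-discrete equation up to `O(h²)`, also at `t = 0`. -/
theorem exists_abs_residual_le (hab : a < b) (hT : 0 < T) (h1 : 1 < α) (h2 : α < 2)
    (hu : IsSolution a b T α K Kα f u0 u) (hux : SpaceRegular a b T u)
    (hut : TimeRegular 3 a b T u) (hft : TimeRegular 2 a b T f) :
    ∃ C : ℝ, 0 ≤ C ∧ ∀ (M : ℕ) (h : ℝ), h = (b - a) / M → ∀ j : ℕ, 1 ≤ j → j < M →
      ∀ t ∈ Icc 0 T,
        |derivWithin (fun s => u (a + j * h) s) (Icc 0 T) t - f (a + j * h) t +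
          spatialOp α K Kα h M (fun i => u (a + i * h) t) j| ≤ C * h ^ 2 := by
  obtain ⟨V, hV⟩ := hux
  obtain ⟨C1, hC1, hriesz⟩ := exists_abs_rieszOp_sub_rieszDeriv_le h1 h2 hab
  obtain ⟨Cu, hut⟩ := hut
  obtain ⟨Cf, hft⟩ := hft
  have hba : 0 ≤ b - a := by linarith
  refine ⟨|K| * (V * (b - a)) + |Kα| * (C1 * V), by positivity, ?_⟩
  intro M h hh j hj hjM
  have hM : (0 : ℝ) < M := by exact_mod_cast (by omega : 0 < M)
  have h0 : 0 < h := by rw [hh]; exact div_pos (by linarith) hM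
  have hMh : (M : ℝ) * h = b - a := by rw [hh]; field_simp
  have hmem : ∀ i : ℕ, 1 ≤ i → i < M → a + i * h ∈ Ioo a b := by
    intro i hi hiM
    have hi' : (1 : ℝ) ≤ i := by exact_mod_cast hi
    have hiM' : (i : ℝ) + 1 ≤ M := by exact_mod_cast hiM
    constructor <;> nlinarith
  have hxj := hmem j hj hjM
  have hjb : a + (j + 1) * h ≤ b := by
    have : (j : ℝ) + 1 ≤ M := by exact_mod_cast hjM
    nlinarith
  set φ : ℝ → ℝ := fun t => derivWithin (fun s => u (a + j * h) s) (Icc 0 T) t -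
    f (a + j * h) t + spatialOp α K Kα h M (fun i => u (a + i * h) t) j with hφ
  have hpos : ∀ t ∈ Ioc 0 T, |φ t| ≤ (|K| * (V * (b - a)) + |Kα| * (C1 * V)) * h ^ 2 := by
    intro t ht
    obtain ⟨hc, w, hw, hi⟩ := hV t ⟨ht.1.le, ht.2⟩
    have hd := hasFourthDeriv_zeroExt hc hw hi
    have r1 := hriesz V w (fun x => u x t) hd M h hh j hj hjM
    have r2 := abs_centralDiff_sub_deriv_le hd h0 hj hjb
    have heq := hu.equation _ hxj t ht
    have e : φ t = K * (centralDiff h (fun i => u (a + i * h) t) j -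
        deriv (fun y => u y t) (a + j * h)) -
        Kα * (rieszOp α h M (fun i => u (a + i * h) t) j -
          rieszDeriv a b α (fun y => u y t) (a + j * h)) := by
      simp only [hφ, spatialOp]
      linear_combination heq
    rw [e]
    refine (abs_sub _ _).trans ?_
    rw [abs_mul, abs_mul]
    calc _ ≤ |K| * (V * (b - a) * h ^ 2) + |Kα| * (C1 * V * h ^ 2) := by gcongr
      _ = _ := by ring
  -- Time regularity covers interior nodes only; at the two end nodes continuity comes from the
  -- boundary conditions.
  have hgrid : ∀ i ≤ M, ContinuousOn (fun t => u (a + i * h) t) (Icc 0 T) := by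
    intro i hi
    rcases Nat.eq_zero_or_pos i with rfl | hi0
    · refine continuousOn_const.congr (f := fun _ => 0) fun t ht => ?_
      simpa using hu.left_boundary t ht
    rcases hi.eq_or_lt with rfl | hiM
    · refine continuousOn_const.congr (f := fun _ => 0) fun t ht => ?_
      rw [hMh, add_sub_cancel]
      exact hu.right_boundary t ht
    · exact (hut _ (hmem i hi0 hiM)).1.continuousOn
  have hcont : ContinuousOn φ (Icc 0 T) := by
    refine ContinuousOn.add (ContinuousOn.sub ?_ (hft _ hxj).1.continuousOn) ?_
    · exact (hut _ hxj).1.continuousOn_derivWithin (uniqueDiffOn_Icc hT) (by norm_num)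
    · simp only [spatialOp, centralDiff, halfDiff, rieszOp, leftOp, rightOp]
      refine ContinuousOn.sub (continuousOn_const.mul (ContinuousOn.div_const (ContinuousOn.add
        (ContinuousOn.div_const (ContinuousOn.sub (hgrid _ (by omega)) (hgrid _ (by omega))) _)
        (ContinuousOn.div_const (ContinuousOn.sub (hgrid _ (by omega)) (hgrid _ (by omega))) _)) _))
        (continuousOn_const.mul (continuousOn_const.mul (ContinuousOn.add
          (continuousOn_const.mul (continuousOn_finsetSum _ fun l hl => ?_))
          (continuousOn_const.mul (continuousOn_finsetSum _ fun l hl => ?_)))))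
      · exact continuousOn_const.mul (hgrid _ (by have := Finset.mem_range.1 hl; omega))
      · exact continuousOn_const.mul (hgrid _ (by have := Finset.mem_range.1 hl; omega))
  intro t ht
  -- The equation is not assumed at `t = 0`, yet the first step uses it; the bound passes to the
  -- limit `t → 0⁺`.
  rcases ht.1.eq_or_lt with rfl | ht0
  · have hz : (0 : ℝ) ∈ Icc 0 T := ⟨le_rfl, hT.le⟩
    have h3 : Tendsto (fun t => |φ t|) (𝓝[Ioc 0 T] 0) (𝓝 |φ 0|) :=
      ((hcont 0 hz).mono Ioc_subset_Icc_self).tendsto.abs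
    have : (𝓝[Ioc 0 T] (0 : ℝ)).NeBot := by
      rw [nhdsWithin_Ioc_eq_nhdsGT hT]; infer_instance
    refine le_of_tendsto h3 ?_
    filter_upwards [self_mem_nhdsWithin] with t ht using hpos t ht
  · exact hpos t ⟨ht0, ht.2⟩

end

end RieszScheme

end

/-! ### Convergence of the scheme -/

theorem theorem9 (a b T α K Kα : ℝ) (hab : a < b) (hT : 0 < T)
    (hα1 : 1 < α) (hα2 : α < 2) (hK : 0 ≤ K) (hKα : 0 < Kα)
    (f : ℝ → ℝ → ℝ) (u0 : ℝ → ℝ) (u : ℝ → ℝ → ℝ)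
    (hu : RieszScheme.IsSolution a b T α K Kα f u0 u)
    (hux : RieszScheme.SpaceRegular a b T u)
    (hut : RieszScheme.TimeRegular 3 a b T u)
    (hft : RieszScheme.TimeRegular 2 a b T f) :
    ∃ c : ℝ, 0 < c ∧
      ∀ M N : ℕ, 1 ≤ M → 1 ≤ N →
      ∀ h τ : ℝ, h = (b - a) / M → τ = T / N →
      ∀ F : ℕ → ℕ → ℝ,
        (F = RieszScheme.midSource a h τ f ∨ F = RieszScheme.avgSource a h τ f) →
      ∀ U : ℕ → ℕ → ℝ, RieszScheme.IsSchemeSolution a α K Kα h τ M N F u0 U →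
      ∀ k ≤ N,
        RieszScheme.gridNorm h M (fun j => u (a + j * h) (k * τ) - U k j) ≤
          c * (τ ^ 2 + h ^ 2) := by
  obtain ⟨C, hC, hres⟩ := RieszScheme.exists_abs_residual_le hab hT hα1 hα2 hu hux hut hft
  obtain ⟨Cu, hut⟩ := hut
  obtain ⟨Cf, hft⟩ := hft
  set B0 : ℝ := |Cu| + |Cf| + C with hB0
  have hB0' : 0 ≤ B0 := by positivity
  -- The summand 1 makes the constant positive even when `B0 = 0`.
  refine ⟨T * (√(b - a) * B0) + 1, by positivity, ?_⟩
  intro M N hM hN h τ hh hτ F hF U hU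
  have hM' : (0 : ℝ) < M := by exact_mod_cast hM
  have hN' : (0 : ℝ) < N := by exact_mod_cast hN
  have h0 : 0 < h := by rw [hh]; exact div_pos (by linarith) hM'
  have hτ0 : 0 < τ := by rw [hτ]; exact div_pos hT hN'
  have hMh : (M : ℝ) * h = b - a := by rw [hh]; field_simp
  have hNτ : (N : ℝ) * τ = T := by rw [hτ]; field_simp
  have hmem : ∀ i : ℕ, 1 ≤ i → i < M → a + i * h ∈ Set.Ioo a b := by
    intro i hi hiM
    have hi' : (1 : ℝ) ≤ i := by exact_mod_cast hi
    have hiM' : (i : ℝ) + 1 ≤ M := by exact_mod_cast hiM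
    constructor <;> nlinarith
  have htime : ∀ k ≤ N, (k : ℝ) * τ ∈ Set.Icc 0 T := by
    intro k hk
    have : (k : ℝ) ≤ N := by exact_mod_cast hk
    exact ⟨by positivity, by rw [← hNτ]; gcongr⟩
  set B : ℝ := B0 * (τ ^ 2 + h ^ 2) with hB
  have hB' : 0 ≤ B := by positivity
  set e : ℕ → ℕ → ℝ := fun k j => u (a + j * h) (k * τ) - U k j with he
  have e0 : ∀ k ≤ N, e k 0 = 0 := by
    intro k hk
    simp only [he, Nat.cast_zero, zero_mul, add_zero]
    rw [hu.left_boundary _ (htime k hk), hU.left_boundary k hk, sub_zero]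
  have eM : ∀ k ≤ N, e k M = 0 := by
    intro k hk
    simp only [he]
    rw [hMh, add_sub_cancel, hu.right_boundary _ (htime k hk), hU.right_boundary k hk, sub_zero]
  have hstep : ∀ k < N, RieszScheme.gridNorm h M (e (k + 1)) ≤
      RieszScheme.gridNorm h M (e k) + τ * (√(b - a) * B) := by
    intro k hk
    -- The residual is by definition what the error leaves in the scheme; only its bound needs
    -- proof.
    refine RieszScheme.gridNorm_step_le (K := K) hα1 hα2 hKα h0 hτ0 hB' hMh (e0 k hk.le)
      (eM k hk.le) (e0 _ hk) (eM _ hk) (fun j _ _ => rfl) ?_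
    intro j hj hjM
    have hx := hmem j hj hjM
    obtain ⟨x, hxdef⟩ : ∃ x, x = a + j * h := ⟨_, rfl⟩
    obtain ⟨t, ht⟩ : ∃ t, t = (k : ℝ) * τ := ⟨_, rfl⟩
    have ht' : ((k + 1 : ℕ) : ℝ) * τ = t + τ := by rw [ht]; push_cast; ring
    have htm : t ∈ Set.Icc 0 T := ht ▸ htime k hk.le
    have htm' : t + τ ∈ Set.Icc 0 T := ht' ▸ htime (k + 1) hk
    have hsub : Set.Icc t (t + τ) ⊆ Set.Icc 0 T := Set.Icc_subset_Icc htm.1 htm'.2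
    have r1 := hres M h hh j hj hjM t htm
    have r2 := hres M h hh j hj hjM (t + τ) htm'
    have hs := hU.step k hk j hj hjM
    rw [← hxdef] at hx r1 r2
    obtain ⟨hux3, hubd⟩ := hut x hx
    obtain ⟨hfx2, hfbd⟩ := hft x hx
    -- trapezoidal rule for the time derivative
    have htrap := RieszScheme.abs_trapezoid_sub_le hτ0.le
      (fun y hy => (RieszScheme.hasDerivWithinAt_iteratedDerivWithin hT hux3 (k := 0)
        (by norm_num) (hsub hy)).mono hsub)
      (fun y hy => (RieszScheme.hasDerivWithinAt_iteratedDerivWithin hT hux3 (k := 1)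
        (by norm_num) (hsub hy)).mono hsub)
      (fun y hy => (RieszScheme.hasDerivWithinAt_iteratedDerivWithin hT hux3 (k := 2)
        (by norm_num) (hsub hy)).mono hsub)
      (fun y hy => (hubd y (hsub hy)).trans (le_abs_self Cu))
    simp only [iteratedDerivWithin_zero, zero_add, iteratedDerivWithin_one] at htrap
    set ut : ℝ → ℝ := derivWithin (fun s => u x s) (Set.Icc 0 T) with hut_def
    have htrap' : |(u x (t + τ) - u x t) / τ - (ut t + ut (t + τ)) / 2| ≤ |Cu| * τ ^ 2 := by
      have : (u x (t + τ) - u x t) / τ - (ut t + ut (t + τ)) / 2 =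
          (u x (t + τ) - u x t - τ * ((ut t + ut (t + τ)) / 2)) / τ := by field_simp
      rw [this, abs_div, abs_of_pos hτ0, div_le_iff₀ hτ0]
      refine htrap.trans (le_of_eq ?_)
      ring
    -- the two choices of the source
    have hsource : |(f x t + f x (t + τ)) / 2 - F k j| ≤ |Cf| * τ ^ 2 := by
      rcases hF with rfl | rfl
      · have hmid := RieszScheme.abs_midpoint_sub_le (g := fun s => f x s) (m := t + τ / 2)
          (σ := τ / 2) (C := |Cf|) (by positivity)
          (g1 := iteratedDerivWithin 1 (fun s => f x s) (Set.Icc 0 T))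
          (g2 := iteratedDerivWithin 2 (fun s => f x s) (Set.Icc 0 T))
        rw [show t + τ / 2 - τ / 2 = t by ring, show t + τ / 2 + τ / 2 = t + τ by ring] at hmid
        have hmid' := hmid
          (fun y hy => by
            have := (RieszScheme.hasDerivWithinAt_iteratedDerivWithin hT hfx2 (k := 0)
              (by norm_num) (hsub hy)).mono hsub
            simpa only [iteratedDerivWithin_zero, zero_add] using this)
          (fun y hy => (RieszScheme.hasDerivWithinAt_iteratedDerivWithin hT hfx2 (k := 1)
            (by norm_num) (hsub hy)).mono hsub)
          (fun y hy => (hfbd y (hsub hy)).trans (le_abs_self Cf))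
        rw [RieszScheme.midSource, ← hxdef, show ((k : ℝ) + 1 / 2) * τ = t + τ / 2 by rw [ht]; ring]
        refine hmid'.trans ?_
        have := mul_nonneg (abs_nonneg Cf) (sq_nonneg τ)
        nlinarith
      · rw [RieszScheme.avgSource, ← hxdef, ← ht,
          show ((k : ℝ) + 1) * τ = t + τ by rw [ht]; ring, sub_self, abs_zero]
        positivity
    have lin1 := RieszScheme.spatialOp_linear α K Kα h M (1 / 2) (1 / 2)
      (fun i => u (a + i * h) (t + τ)) (fun i => u (a + i * h) t) j
    have lin2 := RieszScheme.spatialOp_linear α K Kα h M 1 (-1)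
      (fun i => 1 / 2 * u (a + i * h) (t + τ) + 1 / 2 * u (a + i * h) t)
      (fun i => (U (k + 1) i + U k i) / 2) j
    have hfun : (fun i => (e (k + 1) i + e k i) / 2) = fun i : ℕ =>
        1 * (1 / 2 * u (a + i * h) (t + τ) + 1 / 2 * u (a + i * h) t) +
          -1 * ((U (k + 1) i + U k i) / 2) := by
      ext i
      simp only [he, ht', ← ht]
      ring
    have hUop : RieszScheme.spatialOp α K Kα h M (fun i => (U (k + 1) i + U k i) / 2) j =
        F k j - (U (k + 1) j - U k j) / τ := by
      rw [RieszScheme.spatialOp]; linarith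
    rw [hfun, lin2, lin1, hUop]
    simp only [he, ht', ← ht, ← hxdef]
    set L1 := RieszScheme.spatialOp α K Kα h M (fun i => u (a + i * h) (t + τ)) j
    set L0 := RieszScheme.spatialOp α K Kα h M (fun i => u (a + i * h) t) j
    -- The residual splits into the trapezoidal error, the average of the spatial residuals at both
    -- time levels, and the source error.
    have hsplit : (u x (t + τ) - U (k + 1) j - (u x t - U k j)) / τ +
        (1 * (1 / 2 * L1 + 1 / 2 * L0) + -1 * (F k j - (U (k + 1) j - U k j) / τ)) =
        ((u x (t + τ) - u x t) / τ - (ut t + ut (t + τ)) / 2) +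
        ((ut t - f x t + L0) / 2 + (ut (t + τ) - f x (t + τ) + L1) / 2) +
        ((f x t + f x (t + τ)) / 2 - F k j) := by
      field_simp
      ring
    rw [hsplit]
    have half : ∀ z : ℝ, |z / 2| = |z| / 2 := fun z => by rw [abs_div, abs_two]
    have hr : |(ut t - f x t + L0) / 2 + (ut (t + τ) - f x (t + τ) + L1) / 2| ≤ C * h ^ 2 := by
      refine (abs_add_le _ _).trans ?_
      rw [half, half]
      linarith
    refine (abs_add_le _ _).trans ((add_le_add ((abs_add_le _ _).trans (add_le_add htrap' hr))
      hsource).trans ?_)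
    rw [hB, hB0]
    have p1 : 0 ≤ |Cu| * h ^ 2 := by positivity
    have p2 : 0 ≤ |Cf| * h ^ 2 := by positivity
    have p3 : 0 ≤ C * τ ^ 2 := by positivity
    linarith
  have hall : ∀ k ≤ N, RieszScheme.gridNorm h M (e k) ≤ k * τ * (√(b - a) * B) := by
    intro k
    induction k with
    | zero =>
      intro _
      have : RieszScheme.gridNorm h M (e 0) = 0 := by
        rw [RieszScheme.gridNorm, Finset.sum_eq_zero, mul_zero, Real.sqrt_zero]
        intro j hj
        rw [Finset.mem_Icc] at hj
        have hx := hmem j hj.1 (by omega)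
        simp only [he, Nat.cast_zero, zero_mul]
        rw [hu.initial _ hx, hU.initial j (by omega), sub_self]
        norm_num
      rw [this]
      simp
    | succ k ih =>
      intro hk
      have := hstep k hk
      have := ih (by omega)
      push_cast
      linarith
  intro k hk
  refine (hall k hk).trans ?_
  have hkT := (htime k hk).2
  have hs : 0 ≤ √(b - a) * B := by positivity
  have h4 : (k : ℝ) * τ * (√(b - a) * B) ≤ T * (√(b - a) * B) := by gcongr
  refine h4.trans ?_
  rw [hB]
  have : 0 ≤ τ ^ 2 + h ^ 2 := by positivity
  linarith
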